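/- Let $(E,\mathscr E,\mu)$ be a $\sigma$-finite measure space and let $L$ be a self-adjoint operator on the real space $L^2(\mu)$ with discrete spectrum, with eigenvalues $0<\lambda_1\le\lambda_2\le\cdots\to\infty$ (counted with multiplicity) and corresponding unit eigenfunctions $\{e_k\}_{k\ge1}$ forming an orthonormal basis of $L^2(\mu)$. Let $P_t=\mathrm e^{-tL}$. Assume that the quadratic form of $L$ is a Dirichlet form, i.e. that $P_t$ is sub-Markovian ($0\le f\le 1$ a.e. implies $0\le P_tf\le1$ a.e., for $t>0$), and that for some constants $c,d\in(0,\infty)$ $$\|P_t\|_{L^1(\mu)\to L^\infty(\mu)}\le (ct)^{-d/2},\qquad t>0.$$ Let $H$ be the completion of $L^2(\mu)$ with respect to the inner product $\langle x,y\rangle_H:=\langle x,L^{-1}y\rangle_2=\sum_{k\ge1}\lambda_k^{-1}\langle x,e_k\rangle_2\langle y,e_k\rangle_2$, and let $\mathscr L_2(L^2(\mu);H)$ be the space of Hilbert–Schmidt operators from $L^2(\mu)$ to $H$ with the Hilbert–Schmidt norm. Let $\{\mu_k\}_{k\ge1}\subset\mathbb R$ satisfy $$\sum_{k=1}^\infty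 \mu_k^2\,\lambda_k^{\frac d2\vee(1+\varepsilon)}<\infty$$ for some $\varepsilon>0$, and put $$B(x)h=\sum_{k=1}^\infty \mu_k\langle h,e_k\rangle_2\,x e_k,\qquad x,h\in L^2(\mu).$$ Then all products $xe_k$ lie in $L^2(\mu)$, the series converges in $H$, $B(x)\in\mathscr L_2(L^2(\mu);H)$ for every $x\in L^2(\mu)$, and the linear map $L^2(\mu)\ni x\mapsto B(x)\in\mathscr L_2(L^2(\mu);H)$ extends uniquely by continuity to a continuous linear map on all of $H$. Moreover $$\rho_3:=\tfrac12\sup_{\|x\|_H^2=1}\|B(x)\|_{\mathscr L_2(L^2(\mu);H)}^2<\infty,$$ so that $\|B(x)\|^2_{\mathscr L_2(L^2(\mu);H)}\le 2\rho_3\|x\|_H^2$ for all $x\in H$. -/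

import Mathlib

open MeasureTheory Filter
open scoped ENNReal RealInnerProductSpace

noncomputable section

/-- A self-adjoint operator on the real space `L²(μ)` with discrete, strictly positive spectrum:
the eigenvalues `ev 0 ≤ ev 1 ≤ …` (repeated according to multiplicity) tend to infinity, and the
corresponding unit eigenfunctions `e k` form an orthonormal basis of `L²(μ)`. -/
structure DiscreteOperator {E : Type*} [MeasurableSpace E] (μ : Measure E) where
  /-- the (unbounded) operator `L` with its domain -/
  op : Lp ℝ 2 μ →ₗ.[ℝ] Lp ℝ 2 μ
  selfAdjoint : IsSelfAdjoint op
  /-- the eigenvalues -/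
  ev : ℕ → ℝ
  ev_pos : ∀ k, 0 < ev k
  ev_mono : Monotone ev
  ev_tendsto : Tendsto ev atTop atTop
  /-- the eigenbasis -/
  e : HilbertBasis ℕ ℝ (Lp ℝ 2 μ)
  e_mem : ∀ k, e k ∈ op.domain
  op_e : ∀ k, op ⟨e k, e_mem k⟩ = ev k • e k

namespace DiscreteOperator

variable {E : Type*} [MeasurableSpace E] {μ : Measure E} (L : DiscreteOperator μ)

/-- The semigroup `P_t = e^{-tL}` on `L²(μ)`, `P_t f = ∑ₖ e^{-t λₖ} ⟨eₖ, f⟩ eₖ`. -/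
def semigroup (t : ℝ) (f : Lp ℝ 2 μ) : Lp ℝ 2 μ :=
  ∑' k, (Real.exp (-t * L.ev k) * ⟪L.e k, f⟫) • L.e k

/-- The semigroup is sub-Markovian, that is, the quadratic form of `L` is a Dirichlet form. -/
def IsSubMarkovian : Prop :=
  ∀ t : ℝ, 0 < t → ∀ f : Lp ℝ 2 μ, (∀ᵐ a ∂μ, 0 ≤ f a ∧ f a ≤ 1) →
    ∀ᵐ a ∂μ, 0 ≤ L.semigroup t f a ∧ L.semigroup t f a ≤ 1

/-- `‖P_t‖_{1→∞} ≤ (c t)^{-d/2}` for all `t > 0`. For `f ∈ L²(μ)` outside `L¹(μ)` the right-hand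
side is infinite, so this is the bound on the dense subspace `L¹(μ) ∩ L²(μ)` of `L¹(μ)`. -/
def IsUltracontractive (c d : ℝ) : Prop :=
  ∀ t : ℝ, 0 < t → ∀ f : Lp ℝ 2 μ,
    eLpNorm (L.semigroup t f) ∞ μ ≤ ENNReal.ofReal ((c * t) ^ (-d / 2)) * eLpNorm f 1 μ

/-- The inner product `⟨x, y⟩_H = ⟨x, L⁻¹ y⟩₂ = ∑ₖ ⟨x, eₖ⟩ ⟨y, eₖ⟩ / λₖ` on `L²(μ)`. -/
def hInner (x y : Lp ℝ 2 μ) : ℝ := ∑' k, ⟪x, L.e k⟫ * ⟪y, L.e k⟫ / L.ev k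

theorem summable_hInner (x y : Lp ℝ 2 μ) :
    Summable fun k => ⟪x, L.e k⟫ * ⟪y, L.e k⟫ / L.ev k := by
  have h := (L.e.summable_inner_mul_inner x y).abs.mul_right (L.ev 0)⁻¹
  refine Summable.of_norm_bounded h fun k => ?_
  rw [Real.norm_eq_abs, abs_div, abs_of_pos (L.ev_pos k), div_eq_mul_inv,
    real_inner_comm y (L.e k)]
  exact mul_le_mul_of_nonneg_left
    (inv_anti₀ (L.ev_pos 0) (L.ev_mono (Nat.zero_le k))) (abs_nonneg _)

/-- `hInner` is `⟨x, L⁻¹ ·⟩₂`. -/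
theorem hInner_op (x : Lp ℝ 2 μ) (y : L.op.domain) :
    L.hInner x (L.op y) = ⟪x, (y : Lp ℝ 2 μ)⟫ := by
  have key : ∀ k, ⟪L.op y, L.e k⟫ = L.ev k * ⟪(y : Lp ℝ 2 μ), L.e k⟫ := fun k => by
    have hs : L.op.IsFormalAdjoint L.op := by
      have := LinearPMap.adjoint_isFormalAdjoint (T := L.op) L.selfAdjoint.dense_domain
      rwa [LinearPMap.isSelfAdjoint_def.mp L.selfAdjoint] at this
    have h := hs y ⟨L.e k, L.e_mem k⟩
    rw [L.op_e, real_inner_smul_right] at h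
    exact h
  rw [← (L.e.hasSum_inner_mul_inner x y).tsum_eq]
  refine tsum_congr fun k => ?_
  rw [key, real_inner_comm (y : Lp ℝ 2 μ) (L.e k)]
  field_simp [(L.ev_pos k).ne']

/-- `L²(μ)` with the inner product `⟨·, ·⟩_H`. -/
def PreH (_L : DiscreteOperator μ) : Type _ := Lp ℝ 2 μ

instance : AddCommGroup L.PreH := inferInstanceAs (AddCommGroup (Lp ℝ 2 μ))

instance : Module ℝ L.PreH := inferInstanceAs (Module ℝ (Lp ℝ 2 μ))

/-- The identification of `L²(μ)` with `PreH`. -/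
def toPreH : Lp ℝ 2 μ ≃ₗ[ℝ] L.PreH := LinearEquiv.refl ℝ (Lp ℝ 2 μ)

/-- The axioms of an inner product for `⟨·, ·⟩_H`. -/
@[reducible]
def hCore : InnerProductSpace.Core ℝ L.PreH where
  inner x y := L.hInner (L.toPreH.symm x) (L.toPreH.symm y)
  conj_inner_symm x y := by
    simp only [hInner, conj_trivial]
    exact tsum_congr fun k => by ring
  re_inner_nonneg x := by
    simp only [hInner, RCLike.re_to_real]
    exact tsum_nonneg fun k => div_nonneg (mul_self_nonneg _) (L.ev_pos k).le
  add_left x y z := by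
    simp only [hInner]
    rw [← (L.summable_hInner _ _).tsum_add (L.summable_hInner _ _)]
    exact tsum_congr fun k => by rw [map_add, inner_add_left]; ring
  smul_left x y r := by
    simp only [hInner, conj_trivial]
    rw [← tsum_mul_left]
    exact tsum_congr fun k => by rw [map_smul, real_inner_smul_left]; ring
  definite x hx := by
    have h0 := (hasSum_zero_iff_of_nonneg fun k =>
      div_nonneg (mul_self_nonneg ⟪L.toPreH.symm x, L.e k⟫) (L.ev_pos k).le).mp
      (by
        have hs := (L.summable_hInner (L.toPreH.symm x) (L.toPreH.symm x)).hasSum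
        rwa [← hInner, show L.hInner (L.toPreH.symm x) (L.toPreH.symm x) = 0 from hx] at hs)
    have h1 : ∀ k, ⟪L.toPreH.symm x, L.e k⟫ = 0 := fun k => by
      have h2 := congrFun h0 k
      simpa [(L.ev_pos k).ne'] using h2
    have h3 : ⟪L.toPreH.symm x, L.toPreH.symm x⟫ = 0 := by
      rw [← L.e.tsum_inner_mul_inner]
      simp [h1]
    exact (LinearEquiv.map_eq_zero_iff _).mp (inner_self_eq_zero.mp h3)

instance : NormedAddCommGroup L.PreH := L.hCore.toNormedAddCommGroup

instance : InnerProductSpace ℝ L.PreH := InnerProductSpace.ofCore L.hCore.toCore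

/-- The Hilbert space `H`, the completion of `L²(μ)` with respect to `⟨·, ·⟩_H`. -/
abbrev H : Type _ := UniformSpace.Completion L.PreH

/-- The canonical dense embedding of `L²(μ)` into `H`. -/
def toH (x : Lp ℝ 2 μ) : L.H := (L.toPreH x : UniformSpace.Completion L.PreH)

theorem inner_toH (x y : Lp ℝ 2 μ) : ⟪L.toH x, L.toH y⟫ = L.hInner x y :=
  UniformSpace.Completion.inner_coe _ _

theorem denseRange_toH : DenseRange L.toH :=
  UniformSpace.Completion.denseRange_coe.comp L.toPreH.surjective.denseRange
    (UniformSpace.Completion.continuous_coe _)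

end DiscreteOperator

/-- The product of two elements of `L²(μ)`, where it belongs to `L²(μ)` again (and `0` elsewhere). -/
def mulL2 {E : Type*} [MeasurableSpace E] {μ : Measure E} (x y : Lp ℝ 2 μ) : Lp ℝ 2 μ :=
  open Classical in if h : MemLp (fun a => x a * y a) 2 μ then h.toLp else 0

section HilbertSchmidt

variable {ι V F : Type*} [NormedAddCommGroup V] [InnerProductSpace ℝ V]
  [NormedAddCommGroup F] [InnerProductSpace ℝ F]

/-- The subspace of those bounded operators `T : V → F` with `∑ᵢ ‖T bᵢ‖² < ∞`. -/
def hilbertSchmidtSubmodule (b : HilbertBasis ι ℝ V) (F : Type*) [NormedAddCommGroup F]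
    [InnerProductSpace ℝ F] : Submodule ℝ (V →L[ℝ] F) where
  carrier := {T | Memℓp (fun i => T (b i)) 2}
  add_mem' hS hT := hS.add hT
  zero_mem' := zero_memℓp
  smul_mem' r _ hT := hT.const_smul r

/-- The space of Hilbert–Schmidt operators `V → F`, where `b` is an orthonormal basis of `V` (the
space and its norm do not depend on the basis). It is a type of its own, since it carries the
Hilbert–Schmidt norm and not the operator norm. -/
def HilbertSchmidt (b : HilbertBasis ι ℝ V) (F : Type*) [NormedAddCommGroup F]
    [InnerProductSpace ℝ F] : Type _ := hilbertSchmidtSubmodule b F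

namespace HilbertSchmidt

instance (b : HilbertBasis ι ℝ V) : AddCommGroup (HilbertSchmidt b F) :=
  inferInstanceAs (AddCommGroup (hilbertSchmidtSubmodule b F))

instance (b : HilbertBasis ι ℝ V) : Module ℝ (HilbertSchmidt b F) :=
  inferInstanceAs (Module ℝ (hilbertSchmidtSubmodule b F))

/-- The underlying bounded operator. -/
def toCLM {b : HilbertBasis ι ℝ V} : HilbertSchmidt b F →ₗ[ℝ] V →L[ℝ] F :=
  (hilbertSchmidtSubmodule b F).subtype

/-- `T ↦ (T bᵢ)ᵢ`. -/
def toSeq (b : HilbertBasis ι ℝ V) : HilbertSchmidt b F →ₗ[ℝ] lp (fun _ : ι => F) 2 where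
  toFun T := ⟨fun i => T.toCLM (b i), T.2⟩
  map_add' _ _ := rfl
  map_smul' _ _ := rfl

theorem toSeq_injective (b : HilbertBasis ι ℝ V) :
    Function.Injective (toSeq (F := F) b) := fun S T h => by
  refine Subtype.ext (ContinuousLinearMap.ext_on
    (Submodule.dense_iff_topologicalClosure_eq_top.mpr b.dense_span) ?_)
  rintro _ ⟨i, rfl⟩
  exact congrFun (congrArg Subtype.val h) i

/-- The Hilbert–Schmidt norm `‖T‖ = (∑ᵢ ‖T bᵢ‖²)^{1/2}`. -/
instance (b : HilbertBasis ι ℝ V) : NormedAddCommGroup (HilbertSchmidt b F) :=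
  NormedAddCommGroup.induced _ _ (toSeq b) (toSeq_injective b)

instance (b : HilbertBasis ι ℝ V) : NormedSpace ℝ (HilbertSchmidt b F) :=
  NormedSpace.induced ℝ _ _ (toSeq b)

theorem norm_sq_eq (b : HilbertBasis ι ℝ V) (T : HilbertSchmidt b F) :
    ‖T‖ ^ 2 = ∑' i, ‖T.toCLM (b i)‖ ^ 2 := by
  have h := lp.norm_rpow_eq_tsum (p := 2) (by norm_num) (toSeq b T)
  simp only [ENNReal.toReal_ofNat, Real.rpow_ofNat] at h
  exact h

end HilbertSchmidt

end HilbertSchmidt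

end

/-! Since `B(x) eₖ = μₖ x eₖ`, the squared Hilbert–Schmidt norm of `B(x)` is `∑ μₖ² ‖x eₖ‖_H²`. So
it suffices that multiplication by `eₖ` is bounded on `H` with squared norm at most `C λₖ^p`, where
`p = max (d/2) (1+ε)`; this is `exists_hInner_mul_e_le`. The hypothesis on `μₖ` then sums the
squares, and density of `L²(μ)` in `H` gives the extension and its uniqueness.

Multiplication is symmetric on `L²(μ)` and `H` is dual to the energy norm `𝓔(y,y) = ∑ λⱼ ⟨eⱼ,y⟩²`,
so it is enough to prove `𝓔(eₖy, eₖy) ≤ C λₖ^p 𝓔(y,y)` (`hInner_bddMul_le`). With `Mₖ = ‖eₖ‖_∞`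
there are two steps.

The eigenvalue equation and the Markov property give `𝓔(eₖy, eₖy) ≤ λₖ ∫ eₖ²y² + Mₖ² 𝓔(y,y)`. This
is obtained for the approximate forms `⟨f, f - P_t f⟩ / t`, so neither a carré du champ nor a chain
rule is needed.

The potential `eₖ²` is form bounded: `∫ eₖ²y² ≤ K 𝓔(y,y)` as soon as `K` bounds `∫₀^∞ ‖P_t eₖ²‖_∞
dt`. Here `‖P_t eₖ²‖_∞` is at most `Mₖ²` and at most a multiple of `t^(-p)`; cutting the integral at
`t = 1/λₖ` gives `K` of order `λₖ^(p-1)`, because `Mₖ²` is of order `λₖ^p` by ultracontractivity.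

Both steps rest on one inequality for positive symmetric operators, `inner_bddMul_sub_le`. -/

noncomputable section

/-! ### Bounded multipliers and positive operators on `L²(μ)`. -/

section Multiplication

variable {E : Type*} [MeasurableSpace E] {μ : Measure E}

/-- Multiplication by a bounded function, as a bounded operator on `L²(μ)`. -/
def bddMul (z : Lp ℝ ∞ μ) : Lp ℝ 2 μ →L[ℝ] Lp ℝ 2 μ :=
  LinearMap.mkContinuous
    { toFun := fun f => (z • f : Lp ℝ 2 μ)
      map_add' := fun f g => Lp.add_smul z f g
      map_smul' := fun c f => (Lp.smul_comm c z f).symm } ‖z‖ fun f => Lp.norm_smul_le z f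

theorem coeFn_bddMul (z : Lp ℝ ∞ μ) (f : Lp ℝ 2 μ) :
    bddMul z f =ᵐ[μ] fun a => z a * f a :=
  Lp.coeFn_lpSMul z f

theorem inner_eq_integral_mul (f g : Lp ℝ 2 μ) : ⟪f, g⟫ = ∫ a, f a * g a ∂μ := by
  rw [L2.inner_def]
  exact integral_congr_ae (Eventually.of_forall fun a => mul_comm _ _)

theorem integrable_mul_of_L2 (f g : Lp ℝ 2 μ) : Integrable (fun a => f a * g a) μ :=
  (L2.integrable_inner (𝕜 := ℝ) f g).congr (Eventually.of_forall fun _ => mul_comm _ _)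

theorem inner_bddMul_left (z : Lp ℝ ∞ μ) (f g : Lp ℝ 2 μ) :
    ⟪bddMul z f, g⟫ = ⟪f, bddMul z g⟫ := by
  rw [inner_eq_integral_mul, inner_eq_integral_mul]
  refine integral_congr_ae ?_
  filter_upwards [coeFn_bddMul z f, coeFn_bddMul z g] with a h1 h2
  rw [h1, h2]; ring

/-- A function that is bounded and square integrable occurs as two objects, one in `L^∞` and one in
`L²`. In a product of two such functions either may serve as the multiplier. -/
theorem bddMul_swap {z w : Lp ℝ ∞ μ} {f g : Lp ℝ 2 μ} (hf : z =ᵐ[μ] f) (hg : w =ᵐ[μ] g) :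
    bddMul z g = bddMul w f := by
  apply Lp.ext
  filter_upwards [coeFn_bddMul z g, coeFn_bddMul w f, hf, hg] with a h1 h2 h3 h4
  rw [h1, h2, h3, h4]; ring

theorem inner_nonneg_of_nonneg {f g : Lp ℝ 2 μ} (hf : 0 ≤ f) (hg : 0 ≤ g) : 0 ≤ ⟪f, g⟫ := by
  rw [inner_eq_integral_mul]
  refine integral_nonneg_of_ae ?_
  filter_upwards [(Lp.coeFn_nonneg f).mpr hf, (Lp.coeFn_nonneg g).mpr hg] with a h1 h2
  exact mul_nonneg h1 h2

/-- For a positive operator `P`, `∬ p(a) q(b) (z(a) - z(b))² P(da, db) ≥ 0`. -/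
theorem two_mul_inner_bddMul_le {P : Lp ℝ 2 μ →L[ℝ] Lp ℝ 2 μ} (hP : ∀ f, 0 ≤ f → 0 ≤ P f)
    {p q : Lp ℝ 2 μ} (hp : 0 ≤ p) (hq : 0 ≤ q) (z : Lp ℝ ∞ μ) :
    2 * ⟪bddMul z q, P (bddMul z p)⟫ ≤
      ⟪q, P (bddMul z (bddMul z p))⟫ + ⟪bddMul z (bddMul z q), P p⟫ := by
  set T := bddMul z with hT
  have hs : ∀ s : ℝ, ∀ᵐ a ∂μ, 0 ≤ P (T (T p)) a - 2 * s * P (T p) a + s ^ 2 * P p a := by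
    -- `P` need not be given by a kernel, so `z(a)` is first replaced by a constant `s`: positivity
    -- of `P` is applied to `(z - s)² p ≥ 0`.
    intro s
    have h0 : 0 ≤ T (T p) - (2 * s) • T p + s ^ 2 • p := by
      rw [← Lp.coeFn_nonneg]
      filter_upwards [Lp.coeFn_add (T (T p) - (2 * s) • T p) (s ^ 2 • p),
        Lp.coeFn_sub (T (T p)) ((2 * s) • T p), Lp.coeFn_smul (2 * s) (T p),
        Lp.coeFn_smul (s ^ 2) p, coeFn_bddMul z (T p), coeFn_bddMul z p,
        (Lp.coeFn_nonneg p).mpr hp] with a h1 h2 h3 h4 h5 h6 h7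
      rw [h1, Pi.add_apply, h2, Pi.sub_apply, h3, h4, Pi.smul_apply, Pi.smul_apply, hT, h5, h6,
        Pi.zero_apply, smul_eq_mul, smul_eq_mul]
      have : 0 ≤ (z a - s) ^ 2 * p a := mul_nonneg (sq_nonneg _) h7
      linarith
    have h1 := hP _ h0
    rw [map_add, map_sub, map_smul, map_smul, ← Lp.coeFn_nonneg] at h1
    filter_upwards [h1, Lp.coeFn_add (P (T (T p)) - (2 * s) • P (T p)) (s ^ 2 • P p),
        Lp.coeFn_sub (P (T (T p))) ((2 * s) • P (T p)), Lp.coeFn_smul (2 * s) (P (T p)),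
        Lp.coeFn_smul (s ^ 2) (P p)] with a h1 h2 h3 h4 h5
    rwa [h2, Pi.add_apply, h3, Pi.sub_apply, h4, h5, Pi.smul_apply, Pi.smul_apply,
        Pi.zero_apply, smul_eq_mul, smul_eq_mul] at h1
  -- The null set must not depend on `s` before `s = z(a)` can be inserted: rational `s` give a
  -- common null set, and continuity in `s` gives the rest.
  have hall : ∀ᵐ a ∂μ, ∀ s : ℝ, 0 ≤ P (T (T p)) a - 2 * s * P (T p) a + s ^ 2 * P p a := by
    have h1 : ∀ᵐ a ∂μ, ∀ s : ℚ,
        0 ≤ P (T (T p)) a - 2 * (s : ℝ) * P (T p) a + (s : ℝ) ^ 2 * P p a :=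
      ae_all_iff.mpr fun s => hs s
    filter_upwards [h1] with a ha s
    have hcl : IsClosed {s : ℝ | 0 ≤ P (T (T p)) a - 2 * s * P (T p) a + s ^ 2 * P p a} :=
      isClosed_le continuous_const (by fun_prop)
    exact (Rat.denseRange_cast (𝕜 := ℝ)).induction_on s hcl ha
  have hr : 0 ≤ P (T (T p)) - (2 : ℝ) • T (P (T p)) + T (T (P p)) := by
    rw [← Lp.coeFn_nonneg]
    filter_upwards [hall, Lp.coeFn_add (P (T (T p)) - (2 : ℝ) • T (P (T p))) (T (T (P p))),
      Lp.coeFn_sub (P (T (T p))) ((2 : ℝ) • T (P (T p))), Lp.coeFn_smul (2 : ℝ) (T (P (T p))),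
      coeFn_bddMul z (P (T p)), coeFn_bddMul z (T (P p)), coeFn_bddMul z (P p)]
      with a h1 h2 h3 h4 h5 h6 h7
    rw [h2, Pi.add_apply, h3, Pi.sub_apply, h4, Pi.smul_apply, hT, h5, h6, h7, smul_eq_mul,
      Pi.zero_apply]
    have := h1 (z a)
    rw [hT] at this
    linarith
  have := inner_nonneg_of_nonneg hq hr
  rw [inner_add_right, inner_sub_right, real_inner_smul_right, ← inner_bddMul_left,
    ← inner_bddMul_left, ← inner_bddMul_left] at this
  linarith

/-- For a positive symmetric operator `P` and `|v| ≤ u`,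
`∬ (u(a) u(b) - v(a) v(b)) (z(a) - z(b))² P(da, db) ≥ 0`. -/
theorem inner_bddMul_sub_le {P : Lp ℝ 2 μ →L[ℝ] Lp ℝ 2 μ} (hP : ∀ f, 0 ≤ f → 0 ≤ P f)
    (hsymm : ∀ f g, ⟪P f, g⟫ = ⟪f, P g⟫)
    {u v : Lp ℝ 2 μ} (huv : v ≤ u) (huv' : -v ≤ u) (z : Lp ℝ ∞ μ) :
    ⟪bddMul z (bddMul z v), P v⟫ - ⟪bddMul z v, P (bddMul z v)⟫ ≤
      ⟪bddMul z (bddMul z u), P u⟫ - ⟪bddMul z u, P (bddMul z u)⟫ := by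
  -- In `(u(a) + v(a)) (u(b) - v(b))` the mixed terms are antisymmetric in `a, b`, so they cancel
  -- against the symmetric `P` and leave `u(a)u(b) - v(a)v(b)`.
  have h := two_mul_inner_bddMul_le hP (p := u - v) (q := u + v) (sub_nonneg.mpr huv)
    (by simpa using add_le_add_left huv' v) z
  have e1 : ∀ f g, ⟪f, P g⟫ = ⟪g, P f⟫ := fun f g => by rw [← hsymm, real_inner_comm]
  simp only [map_add, map_sub, inner_add_left, inner_sub_right] at h
  rw [e1 u, e1 u, e1 v, e1 v, e1 (bddMul z u) (bddMul z v)] at h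
  linarith

/-- An `L²` function with `∫_A f ≤ K μ(A)` for all sets of finite measure is bounded by `K`. -/
theorem ae_le_of_forall_inner_indicator_le [SigmaFinite μ] (f : Lp ℝ 2 μ) (K : ℝ)
    (h : ∀ (s : Set E) (hs : MeasurableSet s) (hμ : μ s ≠ ∞),
      ⟪indicatorConstLp 2 hs hμ (1 : ℝ), f⟫ ≤ K * μ.real s) : ∀ᵐ a ∂μ, f a ≤ K := by
  have hint : ∀ s, MeasurableSet s → μ s < ∞ → IntegrableOn (fun a => f a) s μ := fun s hs hμ =>
    integrableOn_Lp_of_measure_ne_top f (by norm_num) hμ.ne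
  have := ae_nonneg_of_forall_setIntegral_nonneg_of_sigmaFinite (μ := μ) (f := fun a => K - f a)
    (fun s hs hμ => (integrableOn_const hμ.ne).sub (hint s hs hμ)) fun s hs hμ => by
      have hK : Integrable (fun _ : E => K) (μ.restrict s) := integrableOn_const hμ.ne
      rw [integral_sub hK (hint s hs hμ), setIntegral_const, smul_eq_mul,
        ← L2.inner_indicatorConstLp_one (𝕜 := ℝ) hs hμ.ne]
      have := h s hs hμ.ne
      linarith
  filter_upwards [this] with a ha
  simpa using ha

/-- The squared error is the integral of `f²` off the exhausting set. These cutoffs stand in for the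
constant function `1`, which is not in `L²(μ)` when `μ` is infinite. -/
theorem tendsto_bddMul_spanningSets [SigmaFinite μ] (f : Lp ℝ 2 μ) :
    Tendsto (fun n => bddMul (indicatorConstLp ∞ (measurableSet_spanningSets μ n)
      (measure_spanningSets_lt_top μ n).ne (1 : ℝ)) f) atTop (nhds f) := by
  set A := spanningSets μ
  rw [tendsto_iff_norm_sub_tendsto_zero]
  have key : ∀ n, ‖bddMul (indicatorConstLp ∞ (measurableSet_spanningSets μ n)
      (measure_spanningSets_lt_top μ n).ne (1 : ℝ)) f - f‖ ^ 2 =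
      (∫ a, f a * f a ∂μ) - ∫ a in A n, f a * f a ∂μ := fun n => by
    rw [← real_inner_self_eq_norm_sq, inner_eq_integral_mul,
      ← integral_indicator (measurableSet_spanningSets μ n), ← integral_sub
      (integrable_mul_of_L2 f f)
      ((integrable_mul_of_L2 f f).indicator (measurableSet_spanningSets μ n))]
    refine integral_congr_ae ?_
    filter_upwards [Lp.coeFn_sub (bddMul (indicatorConstLp ∞ (measurableSet_spanningSets μ n)
      (measure_spanningSets_lt_top μ n).ne (1 : ℝ)) f) f,
      coeFn_bddMul (indicatorConstLp ∞ (measurableSet_spanningSets μ n)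
      (measure_spanningSets_lt_top μ n).ne (1 : ℝ)) f,
      indicatorConstLp_coeFn (p := ∞) (hs := measurableSet_spanningSets μ n)
      (hμs := (measure_spanningSets_lt_top μ n).ne) (c := (1 : ℝ))] with a h1 h2 h3
    rw [h1, Pi.sub_apply, h2, h3]
    by_cases ha : a ∈ spanningSets μ n <;> simp [ha]
  have hlim : Tendsto (fun n => (∫ a, f a * f a ∂μ) - ∫ a in A n, f a * f a ∂μ) atTop
      (nhds 0) := by
    have := tendsto_setIntegral_of_monotone (μ := μ) (f := fun a => f a * f a)
      (fun n => measurableSet_spanningSets μ n) (monotone_spanningSets μ)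
      (integrable_mul_of_L2 f f).integrableOn
    rw [iUnion_spanningSets, setIntegral_univ] at this
    simpa using this.const_sub (∫ a, f a * f a ∂μ)
  have := (hlim.congr fun n => (key n).symm).sqrt
  simpa [Real.sqrt_sq (norm_nonneg _)] using this

theorem ae_abs_le_of_ae_le {f : Lp ℝ 2 μ} {K : ℝ} (h1 : ∀ᵐ a ∂μ, f a ≤ K)
    (h2 : ∀ᵐ a ∂μ, (-f : Lp ℝ 2 μ) a ≤ K) : ∀ᵐ a ∂μ, |f a| ≤ K := by
  filter_upwards [h1, h2, Lp.coeFn_neg f] with a h1 h2 h3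
  rw [h3, Pi.neg_apply] at h2
  exact abs_le.mpr ⟨by linarith, h1⟩

/-- A symmetric operator `P` with `0 ≤ P 1_A ≤ 1` and an eigenfunction `e` of `P` that is bounded
by `M` satisfy `⟨e y, (1 - P) (e y)⟩ ≤ (1 - r) ‖e y‖² + M² ⟨y, (1 - P) y⟩`. -/
theorem inner_bddMul_eigenfunction_le [SigmaFinite μ] {P : Lp ℝ 2 μ →L[ℝ] Lp ℝ 2 μ}
    (hP : ∀ f, 0 ≤ f → 0 ≤ P f) (hsymm : ∀ f g, ⟪P f, g⟫ = ⟪f, P g⟫)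
    (hP1 : ∀ (s : Set E) (hs : MeasurableSet s) (hμ : μ s ≠ ∞),
      ∀ᵐ a ∂μ, P (indicatorConstLp 2 hs hμ (1 : ℝ)) a ≤ 1)
    {e : Lp ℝ 2 μ} {M r : ℝ} (he : P e = r • e) (heM : ∀ᵐ a ∂μ, |e a| ≤ M)
    {ze zy : Lp ℝ ∞ μ} {y : Lp ℝ 2 μ} (hze : ze =ᵐ[μ] e) (hzy : zy =ᵐ[μ] y) :
    r * ‖bddMul ze y‖ ^ 2 - ⟪bddMul ze y, P (bddMul ze y)⟫ ≤
      M ^ 2 * (‖y‖ ^ 2 - ⟪y, P y⟫) := by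
  have hey : bddMul zy e = bddMul ze y := bddMul_swap hzy hze
  let χ : ℕ → Lp ℝ ∞ μ := fun n => indicatorConstLp ∞ (measurableSet_spanningSets μ n)
    (measure_spanningSets_lt_top μ n).ne (1 : ℝ)
  let o : ℕ → Lp ℝ 2 μ := fun n => indicatorConstLp 2 (measurableSet_spanningSets μ n)
    (measure_spanningSets_lt_top μ n).ne (1 : ℝ)
  have hχ : ∀ n, χ n =ᵐ[μ] (spanningSets μ n).indicator fun _ => 1 := fun n =>
    indicatorConstLp_coeFn
  have ho : ∀ n, o n =ᵐ[μ] (spanningSets μ n).indicator fun _ => 1 := fun n =>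
    indicatorConstLp_coeFn
  have hzo : ∀ n, bddMul zy (o n) = bddMul (χ n) y := fun n =>
    bddMul_swap hzy ((hχ n).trans (ho n).symm)
  have hn : ∀ n, ⟪bddMul zy (bddMul zy (bddMul (χ n) e)), P (bddMul (χ n) e)⟫ -
      ⟪bddMul zy (bddMul (χ n) e), P (bddMul zy (bddMul (χ n) e))⟫ ≤
      M ^ 2 * (‖y‖ ^ 2 - ⟪bddMul (χ n) y, P (bddMul (χ n) y)⟫) := fun n => by
    have hle : ∀ᵐ a ∂μ, |bddMul (χ n) e a| ≤ (M • o n) a := by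
      filter_upwards [coeFn_bddMul (χ n) e, hχ n, ho n, heM, Lp.coeFn_smul M (o n)]
        with a h1 h2 h3 h4 h5
      rw [h1, h5, Pi.smul_apply, h2, h3]
      by_cases ha : a ∈ spanningSets μ n <;> simp [ha, h4]
    -- The truncated eigenfunction is dominated by the truncated constant `M`, and the multiplier is
    -- `y`; this exchanges the form of `e y` for `M²` times that of `y`.
    refine (inner_bddMul_sub_le hP hsymm (u := M • o n) (v := bddMul (χ n) e) ?_ ?_ zy).trans ?_
    · rw [← Lp.coeFn_le]
      filter_upwards [hle] with a ha using (le_abs_self _).trans ha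
    · rw [← Lp.coeFn_le]
      filter_upwards [hle, Lp.coeFn_neg (bddMul (χ n) e)] with a ha h
      rw [h]
      exact (neg_le_abs _).trans ha
    · simp only [map_smul, real_inner_smul_left, real_inner_smul_right]
      rw [hzo]
      -- This is where `P 1_A ≤ 1` enters.
      have : ⟪bddMul zy (bddMul (χ n) y), P (o n)⟫ ≤ ‖y‖ ^ 2 := by
        rw [← real_inner_self_eq_norm_sq, inner_eq_integral_mul, inner_eq_integral_mul]
        refine integral_mono_ae (integrable_mul_of_L2 _ _) (integrable_mul_of_L2 _ _) ?_
        filter_upwards [coeFn_bddMul zy (bddMul (χ n) y), coeFn_bddMul (χ n) y, hzy, hχ n,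
          hP1 _ (measurableSet_spanningSets μ n) (measure_spanningSets_lt_top μ n).ne]
          with a h1 h2 h3 h4 h5
        rw [h1, h2, h3, h4]
        by_cases ha : a ∈ spanningSets μ n
        · simp only [ha, Set.indicator_of_mem, one_mul]
          exact mul_le_of_le_one_right (mul_self_nonneg _) h5
        · simp [ha, mul_self_nonneg]
      have := mul_le_mul_of_nonneg_left this (sq_nonneg M)
      linarith
  have hχe : Tendsto (fun n => bddMul (χ n) e) atTop (nhds e) := tendsto_bddMul_spanningSets e
  have hχy : Tendsto (fun n => bddMul (χ n) y) atTop (nhds y) := tendsto_bddMul_spanningSets y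
  have hz := ((bddMul zy).continuous.tendsto e).comp hχe
  have hzz := ((bddMul zy).continuous.tendsto _).comp hz
  have hlim := le_of_tendsto_of_tendsto'
    ((hzz.inner ((P.continuous.tendsto e).comp hχe)).sub
      (hz.inner ((P.continuous.tendsto _).comp hz)))
    ((tendsto_const_nhds.sub (hχy.inner ((P.continuous.tendsto y).comp hχy))).const_mul (M ^ 2)) hn
  -- In the limit the first term is `⟨y² e, P e⟩ = r ‖e y‖²`, by the eigenvalue equation.
  rw [he, real_inner_smul_right, inner_bddMul_left, hey, real_inner_self_eq_norm_sq] at hlim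
  exact hlim

end Multiplication

/-! ### The semigroup in the eigenbasis. -/

theorem HasSum.of_forall_eq {ι : Type*} {f g : ι → ℝ} {a : ℝ} (h : HasSum f a)
    (hfg : ∀ i, g i = f i) : HasSum g a :=
  (funext hfg : g = f) ▸ h

namespace DiscreteOperator

variable {E : Type*} [MeasurableSpace E] {μ : Measure E} (L : DiscreteOperator μ)

theorem ext_inner_e {f g : Lp ℝ 2 μ} (h : ∀ k, ⟪L.e k, f⟫ = ⟪L.e k, g⟫) : f = g := by
  apply L.e.repr.injective
  ext k
  rw [L.e.repr_apply_apply, L.e.repr_apply_apply, h]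

theorem inner_e_e (j k : ℕ) : ⟪L.e j, L.e k⟫ = if j = k then (1 : ℝ) else 0 :=
  orthonormal_iff_ite.mp L.e.orthonormal j k

theorem hasSum_inner_sq (f : Lp ℝ 2 μ) : HasSum (fun k => ⟪L.e k, f⟫ ^ 2) (‖f‖ ^ 2) := by
  have := L.e.hasSum_inner_mul_inner f f
  rw [real_inner_self_eq_norm_sq] at this
  refine this.of_forall_eq fun k => ?_
  rw [real_inner_comm f, sq]

theorem inner_e_semigroup {t : ℝ} (ht : 0 ≤ t) (f : Lp ℝ 2 μ) (j : ℕ) :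
    ⟪L.e j, L.semigroup t f⟫ = Real.exp (-t * L.ev j) * ⟪L.e j, f⟫ := by
  have hmem : Memℓp (fun k => Real.exp (-t * L.ev k) * ⟪L.e k, f⟫) 2 := by
    refine memℓp_gen ?_
    simp only [ENNReal.toReal_ofNat, Real.rpow_ofNat, Real.norm_eq_abs, sq_abs]
    refine Summable.of_nonneg_of_le (fun k => sq_nonneg _) (fun k => ?_)
      (L.hasSum_inner_sq f).summable
    rw [mul_pow]
    refine mul_le_of_le_one_left (sq_nonneg _) (pow_le_one₀ (Real.exp_nonneg _) ?_)
    rw [Real.exp_le_one_iff]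
    nlinarith [L.ev_pos k]
  have h := (L.e.hasSum_repr_symm ⟨_, hmem⟩).tsum_eq
  have h2 : L.semigroup t f = L.e.repr.symm ⟨_, hmem⟩ := h
  rw [h2, ← L.e.repr_apply_apply, LinearIsometryEquiv.apply_symm_apply]

/-- The semigroup at a nonnegative time, as a bounded operator. -/
def semigroupCLM {t : ℝ} (ht : 0 ≤ t) : Lp ℝ 2 μ →L[ℝ] Lp ℝ 2 μ :=
  LinearMap.mkContinuous
    { toFun := L.semigroup t
      map_add' := fun f g => L.ext_inner_e fun k => by
        rw [inner_add_right, L.inner_e_semigroup ht, L.inner_e_semigroup ht,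
          L.inner_e_semigroup ht, inner_add_right, mul_add]
      map_smul' := fun c f => L.ext_inner_e fun k => by
        rw [RingHom.id_apply, real_inner_smul_right, L.inner_e_semigroup ht,
          L.inner_e_semigroup ht, real_inner_smul_right]; ring } 1 fun f => by
    rw [one_mul]
    refine le_of_sq_le_sq ?_ (norm_nonneg _)
    refine hasSum_le (fun k => ?_) (L.hasSum_inner_sq _) (L.hasSum_inner_sq f)
    simp only [LinearMap.coe_mk, AddHom.coe_mk]
    rw [L.inner_e_semigroup ht, mul_pow]
    refine mul_le_of_le_one_left (sq_nonneg _) (pow_le_one₀ (Real.exp_nonneg _) ?_)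
    rw [Real.exp_le_one_iff]
    nlinarith [L.ev_pos k]

theorem semigroupCLM_apply {t : ℝ} (ht : 0 ≤ t) (f : Lp ℝ 2 μ) :
    L.semigroupCLM ht f = L.semigroup t f := rfl

theorem inner_e_semigroupCLM {t : ℝ} (ht : 0 ≤ t) (f : Lp ℝ 2 μ) (j : ℕ) :
    ⟪L.e j, L.semigroupCLM ht f⟫ = Real.exp (-t * L.ev j) * ⟪L.e j, f⟫ :=
  L.inner_e_semigroup ht f j

theorem hasSum_inner_semigroup {t : ℝ} (ht : 0 ≤ t) (f g : Lp ℝ 2 μ) :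
    HasSum (fun k => Real.exp (-t * L.ev k) * (⟪L.e k, f⟫ * ⟪L.e k, g⟫))
      ⟪f, L.semigroupCLM ht g⟫ := by
  have h := L.e.hasSum_inner_mul_inner f (L.semigroupCLM ht g)
  simp only [inner_e_semigroupCLM] at h
  refine h.of_forall_eq fun k => ?_
  rw [real_inner_comm f]; ring

theorem semigroupCLM_symm {t : ℝ} (ht : 0 ≤ t) (f g : Lp ℝ 2 μ) :
    ⟪L.semigroupCLM ht f, g⟫ = ⟪f, L.semigroupCLM ht g⟫ := by
  rw [real_inner_comm]
  refine (L.hasSum_inner_semigroup ht g f).unique ?_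
  exact (L.hasSum_inner_semigroup ht f g).of_forall_eq fun k => by ring

theorem semigroupCLM_e {t : ℝ} (ht : 0 ≤ t) (k : ℕ) :
    L.semigroupCLM ht (L.e k) = Real.exp (-t * L.ev k) • L.e k := by
  refine L.ext_inner_e fun j => ?_
  rw [inner_e_semigroupCLM, real_inner_smul_right, inner_e_e]
  split_ifs with h
  · rw [h]
  · simp

theorem semigroupCLM_half {t : ℝ} (ht : 0 < t) (f : Lp ℝ 2 μ) :
    L.semigroupCLM ht.le f =
      L.semigroupCLM (half_pos ht).le (L.semigroupCLM (half_pos ht).le f) := by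
  refine L.ext_inner_e fun j => ?_
  rw [inner_e_semigroupCLM, inner_e_semigroupCLM, inner_e_semigroupCLM, ← mul_assoc,
    ← Real.exp_add]
  ring_nf

/-- Of the two factors `e^{-tλₖ}` in the squared coefficient, one is bounded by its value at the
lowest eigenvalue. The other is kept, so that ultracontractivity at time `t` still applies. -/
theorem norm_semigroupCLM_sq_le {t : ℝ} (ht : 0 ≤ t) (f : Lp ℝ 2 μ) :
    ‖L.semigroupCLM ht f‖ ^ 2 ≤ Real.exp (-t * L.ev 0) * ⟪f, L.semigroupCLM ht f⟫ := by
  refine hasSum_le (fun k => ?_) (L.hasSum_inner_sq _)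
    ((L.hasSum_inner_semigroup ht f f).mul_left _)
  rw [inner_e_semigroupCLM]
  have h : Real.exp (-t * L.ev k) ≤ Real.exp (-t * L.ev 0) := by
    rw [Real.exp_le_exp]
    nlinarith [L.ev_mono (Nat.zero_le k)]
  have := mul_le_mul_of_nonneg_right h
    (mul_nonneg (Real.exp_nonneg (-t * L.ev k)) (sq_nonneg ⟪L.e k, f⟫))
  linarith

/-! ### Positivity and contraction from the sub-Markov property. -/

section SubMarkovian

variable {L}

theorem IsSubMarkovian.indicator (hL : L.IsSubMarkovian) {t : ℝ} (ht : 0 < t) {s : Set E}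
    (hs : MeasurableSet s) (hμ : μ s ≠ ∞) :
    ∀ᵐ a ∂μ, 0 ≤ L.semigroupCLM ht.le (indicatorConstLp 2 hs hμ (1 : ℝ)) a ∧
      L.semigroupCLM ht.le (indicatorConstLp 2 hs hμ (1 : ℝ)) a ≤ 1 := by
  refine hL t ht _ ?_
  filter_upwards [indicatorConstLp_coeFn (p := 2) (hs := hs) (hμs := hμ) (c := (1 : ℝ))] with a h
  rw [h]
  by_cases ha : a ∈ s <;> simp [ha]

/-- The sub-Markov property speaks only of functions with values in `[0,1]`. Symmetry moves `P_t`
onto indicators, which covers unbounded `f` as well. -/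
theorem IsSubMarkovian.nonneg [SigmaFinite μ] (hL : L.IsSubMarkovian) {t : ℝ} (ht : 0 < t)
    {f : Lp ℝ 2 μ} (hf : 0 ≤ f) : 0 ≤ L.semigroupCLM ht.le f := by
  have h := ae_le_of_forall_inner_indicator_le (-(L.semigroupCLM ht.le f)) 0
    fun s hs hμ => by
      rw [inner_neg_right, zero_mul, ← semigroupCLM_symm, neg_nonpos]
      refine inner_nonneg_of_nonneg ?_ hf
      rw [← Lp.coeFn_nonneg]
      filter_upwards [hL.indicator ht hs hμ] with a ha using ha.1
  rw [← Lp.coeFn_nonneg]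
  filter_upwards [h, Lp.coeFn_neg (L.semigroupCLM ht.le f)] with a h1 h2
  rw [h2, Pi.neg_apply] at h1
  simpa using h1

theorem IsSubMarkovian.le_const (hL : L.IsSubMarkovian) {t : ℝ} (ht : 0 < t)
    {f : Lp ℝ 2 μ} {K : ℝ} (hK : 0 < K) (hf : ∀ᵐ a ∂μ, 0 ≤ f a ∧ f a ≤ K) :
    ∀ᵐ a ∂μ, L.semigroupCLM ht.le f a ≤ K := by
  have h := hL t ht (K⁻¹ • f) (by
    filter_upwards [hf, Lp.coeFn_smul K⁻¹ f] with a ha h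
    rw [h, Pi.smul_apply, smul_eq_mul]
    exact ⟨mul_nonneg (inv_nonneg.mpr hK.le) ha.1, by
      rw [inv_mul_le_iff₀ hK, mul_one]; exact ha.2⟩)
  rw [← semigroupCLM_apply L ht.le, map_smul] at h
  filter_upwards [h, Lp.coeFn_smul K⁻¹ (L.semigroupCLM ht.le f)] with a h1 h2
  rw [h2, Pi.smul_apply, smul_eq_mul] at h1
  have := h1.2
  rwa [inv_mul_le_iff₀ hK, mul_one] at this

end SubMarkovian

/-! ### Consequences of ultracontractivity and the spectral gap. -/

theorem IsUltracontractive.inner_le {L : DiscreteOperator μ} {c d : ℝ}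
    (hU : L.IsUltracontractive c d) (hc : 0 < c)
    {t : ℝ} (ht : 0 < t) {f : Lp ℝ 2 μ} (hf : Integrable f μ) :
    ⟪f, L.semigroupCLM ht.le f⟫ ≤ (c * t) ^ (-d / 2) * (∫ a, |f a| ∂μ) ^ 2 := by
  have hK : 0 ≤ (c * t) ^ (-d / 2) := Real.rpow_nonneg (mul_pos hc ht).le _
  have hI : 0 ≤ ∫ a, |f a| ∂μ := integral_nonneg fun a => abs_nonneg _
  have hae : ∀ᵐ a ∂μ, |L.semigroupCLM ht.le f a| ≤ (c * t) ^ (-d / 2) * ∫ a, |f a| ∂μ := by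
    have h := hU t ht f
    have h1 : eLpNorm f 1 μ = ENNReal.ofReal (∫ a, |f a| ∂μ) := by
      rw [eLpNorm_one_eq_lintegral_enorm, ← ofReal_integral_norm_eq_lintegral_enorm hf]
      rfl
    rw [h1, ← ENNReal.ofReal_mul hK, eLpNorm_exponent_top] at h
    filter_upwards [ae_le_eLpNormEssSup (f := L.semigroup t f) (μ := μ)] with a ha
    have := ha.trans h
    rw [← ofReal_norm, ENNReal.ofReal_le_ofReal_iff (mul_nonneg hK hI)] at this
    exact this
  rw [inner_eq_integral_mul, sq, ← mul_assoc, ← integral_const_mul]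
  refine integral_mono_ae (integrable_mul_of_L2 _ _) (hf.abs.const_mul _) ?_
  filter_upwards [hae] with a ha
  calc f a * L.semigroupCLM ht.le f a ≤ |f a| * |L.semigroupCLM ht.le f a| := by
        rw [← abs_mul]; exact le_abs_self _
    _ ≤ |f a| * ((c * t) ^ (-d / 2) * ∫ a, |f a| ∂μ) :=
        mul_le_mul_of_nonneg_left ha (abs_nonneg _)
    _ = _ := by ring

/-- Used with `α = p - d/2`: exponential decay from the spectral gap pays for replacing `t^(-d/2)`
by `t^(-p)`. Choosing `p > 1` then makes the bound integrable at infinity even when `d ≤ 2`. -/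
theorem exists_exp_neg_mul_rpow_le {l α : ℝ} (hl : 0 < l) (hα : 0 ≤ α) :
    ∃ K, 0 < K ∧ ∀ t, 0 < t → Real.exp (-t * l) * t ^ α ≤ K := by
  obtain ⟨n, hn⟩ := exists_nat_ge α
  refine ⟨1 + n.factorial / l ^ n, by positivity, fun t ht => ?_⟩
  have h1 : t ^ α ≤ 1 + t ^ n := by
    rcases le_total t 1 with h | h
    · exact (Real.rpow_le_one ht.le h hα).trans (by linarith [pow_pos ht n])
    · have := Real.rpow_le_rpow_of_exponent_le h hn
      rw [Real.rpow_natCast] at this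
      linarith
  have h2 := Real.pow_div_factorial_le_exp (t * l) (by positivity) n
  have h3 : t ^ n ≤ n.factorial / l ^ n * Real.exp (t * l) := by
    rw [mul_pow, div_le_iff₀ (by positivity)] at h2
    rw [div_mul_eq_mul_div, le_div_iff₀ (by positivity)]
    linarith
  have h4 : Real.exp (-t * l) * Real.exp (t * l) = 1 := by
    rw [← Real.exp_add]; simp
  have h5 : Real.exp (-t * l) ≤ 1 := by
    rw [Real.exp_le_one_iff]; nlinarith
  calc Real.exp (-t * l) * t ^ α
      ≤ Real.exp (-t * l) * (1 + n.factorial / l ^ n * Real.exp (t * l)) := by gcongr; linarith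
    _ = Real.exp (-t * l) + n.factorial / l ^ n * (Real.exp (-t * l) * Real.exp (t * l)) := by ring
    _ ≤ _ := by rw [h4]; linarith

/-- The ultracontractive bound and the spectral gap give
`‖P_t‖_{1→2} ≤ √C t^{-p/2}` for every `p ≥ d/2`. -/
theorem IsUltracontractive.exists_norm_le {L : DiscreteOperator μ} {c d : ℝ}
    (hU : L.IsUltracontractive c d) (hc : 0 < c) {p : ℝ} (hp : d / 2 ≤ p) :
    ∃ C, 0 < C ∧ ∀ (t : ℝ) (ht : 0 < t) (f : Lp ℝ 2 μ), Integrable f μ →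
      ‖L.semigroupCLM ht.le f‖ ≤ Real.sqrt (C * t ^ (-p)) * ∫ a, |f a| ∂μ := by
  obtain ⟨K, hK, h⟩ := exists_exp_neg_mul_rpow_le (L.ev_pos 0) (sub_nonneg.mpr hp)
  refine ⟨c ^ (-d / 2) * K, by positivity, fun t ht f hf => ?_⟩
  have hI : 0 ≤ ∫ a, |f a| ∂μ := integral_nonneg fun a => abs_nonneg _
  rw [← Real.sqrt_sq hI, ← Real.sqrt_mul (by positivity)]
  refine Real.le_sqrt_of_sq_le ?_
  refine (L.norm_semigroupCLM_sq_le ht.le f).trans ?_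
  have h1 := hU.inner_le hc ht hf
  calc _ ≤ Real.exp (-t * L.ev 0) * ((c * t) ^ (-d / 2) * (∫ a, |f a| ∂μ) ^ 2) := by gcongr
    _ = c ^ (-d / 2) * (Real.exp (-t * L.ev 0) * t ^ (p - d / 2)) * t ^ (-p) *
          (∫ a, |f a| ∂μ) ^ 2 := by
        rw [Real.mul_rpow hc.le ht.le, show -d / 2 = (p - d / 2) + -p by ring,
          Real.rpow_add ht]
        ring
    _ ≤ _ := by
        have := h t ht
        gcongr

theorem integral_abs_indicatorConstLp {s : Set E} (hs : MeasurableSet s) (hμ : μ s ≠ ∞) :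
    ∫ a, |indicatorConstLp 2 hs hμ (1 : ℝ) a| ∂μ = μ.real s := by
  have : (fun a => |indicatorConstLp 2 hs hμ (1 : ℝ) a|) =ᵐ[μ] s.indicator fun _ => (1 : ℝ) := by
    filter_upwards [indicatorConstLp_coeFn (p := 2) (hs := hs) (hμs := hμ) (c := (1 : ℝ))]
      with a h
    rw [h]
    by_cases ha : a ∈ s <;> simp [ha]
  rw [integral_congr_ae this, integral_indicator hs]
  simp

theorem integrable_indicatorConstLp {s : Set E} (hs : MeasurableSet s) (hμ : μ s ≠ ∞) :
    Integrable (indicatorConstLp 2 hs hμ (1 : ℝ)) μ :=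
  ((integrable_indicator_iff hs).mpr (integrableOn_const hμ)).congr
    (indicatorConstLp_coeFn (p := 2) (hs := hs) (hμs := hμ) (c := (1 : ℝ))).symm

/-- If `‖P_t f‖₂ ≤ D ‖f‖₁`, then the eigenfunctions are bounded by `e^{t λₖ} D`. -/
theorem abs_e_le [SigmaFinite μ] {t : ℝ} (ht : 0 < t) {D : ℝ}
    (hD : ∀ f : Lp ℝ 2 μ, Integrable f μ → ‖L.semigroupCLM ht.le f‖ ≤ D * ∫ a, |f a| ∂μ)
    (k : ℕ) : ∀ᵐ a ∂μ, |L.e k a| ≤ Real.exp (t * L.ev k) * D := by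
  have key : ∀ (s : Set E) (hs : MeasurableSet s) (hμ : μ s ≠ ∞),
      |⟪indicatorConstLp 2 hs hμ (1 : ℝ), L.e k⟫| ≤ Real.exp (t * L.ev k) * D * μ.real s := by
    intro s hs hμ
    -- Write `eₖ = e^{tλₖ} P_t eₖ` and move `P_t` onto the indicator, where the `L¹`–`L²` bound
    -- applies.
    have h1 : ⟪indicatorConstLp 2 hs hμ (1 : ℝ), L.e k⟫ = Real.exp (t * L.ev k) *
        ⟪L.semigroupCLM ht.le (indicatorConstLp 2 hs hμ (1 : ℝ)), L.e k⟫ := by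
      rw [semigroupCLM_symm, semigroupCLM_e, real_inner_smul_right, ← mul_assoc, ← Real.exp_add]
      simp
    have h2 := abs_real_inner_le_norm
      (L.semigroupCLM ht.le (indicatorConstLp 2 hs hμ (1 : ℝ))) (L.e k)
    rw [L.e.orthonormal.1 k, mul_one] at h2
    have h3 := hD _ (integrable_indicatorConstLp hs hμ)
    rw [integral_abs_indicatorConstLp] at h3
    rw [h1, abs_mul, abs_of_pos (Real.exp_pos _), mul_assoc]
    exact mul_le_mul_of_nonneg_left (h2.trans h3) (Real.exp_nonneg _)
  refine ae_abs_le_of_ae_le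
    (ae_le_of_forall_inner_indicator_le _ _ fun s hs hμ => (le_abs_self _).trans (key s hs hμ))
    (ae_le_of_forall_inner_indicator_le _ _ fun s hs hμ => ?_)
  rw [inner_neg_right]
  exact (neg_le_abs _).trans (key s hs hμ)

/-- If `‖P_{t/2} f‖₂ ≤ D ‖f‖₁`, then `P_t f ≤ D² ‖f‖₁`. -/
theorem semigroupCLM_le [SigmaFinite μ] {t : ℝ} (ht : 0 < t) {D : ℝ}
    (hD : ∀ f : Lp ℝ 2 μ, Integrable f μ →
      ‖L.semigroupCLM (half_pos ht).le f‖ ≤ D * ∫ a, |f a| ∂μ)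
    {f : Lp ℝ 2 μ} (hf : Integrable f μ) :
    ∀ᵐ a ∂μ, L.semigroupCLM ht.le f a ≤ D ^ 2 * ∫ a, |f a| ∂μ := by
  refine ae_le_of_forall_inner_indicator_le _ _ fun s hs hμ => ?_
  -- `⟨1_A, P_t f⟩ = ⟨P_{t/2} 1_A, P_{t/2} f⟩`, so the `L¹`–`L²` bound is used once on each side.
  rw [semigroupCLM_half L ht, ← semigroupCLM_symm]
  have h3 := hD _ (integrable_indicatorConstLp hs hμ)
  rw [integral_abs_indicatorConstLp] at h3
  refine (real_inner_le_norm _ _).trans ((mul_le_mul h3 (hD f hf) (norm_nonneg _)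
    ((norm_nonneg _).trans h3)).trans_eq ?_)
  ring

end DiscreteOperator

/-! ### Time integrals and difference quotients. -/

/-- Integrate `1 / l = ∫₀^∞ e^{-tl} dt`, using the constant bound up to time `s` and the power
bound, integrable since `p > 1`, after it. -/
theorem sum_div_le_of_sum_exp_le {ι : Type*} (S : Finset ι) {l a : ι → ℝ} (hl : ∀ j, 0 < l j)
    {A D s p : ℝ} (hs : 0 < s) (hp : 1 < p)
    (h1 : ∀ t, 0 < t → ∑ j ∈ S, Real.exp (-t * l j) * a j ≤ A)
    (h2 : ∀ t, 0 < t → ∑ j ∈ S, Real.exp (-t * l j) * a j ≤ D * t ^ (-p)) :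
    ∑ j ∈ S, a j / l j ≤ A * s + D * (s ^ (1 - p) / (p - 1)) := by
  set F : ℝ → ℝ := fun t => ∑ j ∈ S, Real.exp (-t * l j) * a j with hF
  have hint : ∀ j, IntegrableOn (fun t => Real.exp (-t * l j) * a j) (Set.Ioi 0) := fun j => by
    have : IntegrableOn (fun t => Real.exp (-l j * t) * a j) (Set.Ioi 0) :=
      (integrableOn_exp_mul_Ioi (neg_lt_zero.mpr (hl j)) 0).mul_const (a j)
    refine this.congr_fun (fun t _ => ?_) measurableSet_Ioi
    simp only [neg_mul, mul_comm t]
  have hFint : IntegrableOn F (Set.Ioi 0) := integrable_finsetSum _ fun j _ => hint j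
  have hsum : ∫ t in Set.Ioi (0 : ℝ), F t = ∑ j ∈ S, a j / l j := by
    rw [hF, integral_finsetSum _ fun j _ => hint j]
    refine Finset.sum_congr rfl fun j _ => ?_
    rw [integral_mul_const]
    have := integral_exp_mul_Ioi (neg_lt_zero.mpr (hl j)) 0
    rw [show (fun t : ℝ => Real.exp (-t * l j)) = fun t => Real.exp (-l j * t) by
      ext t; ring_nf, this]
    have := (hl j).ne'
    simp
    field_simp
  have hsplit : Set.Ioc (0 : ℝ) s ∪ Set.Ioi s = Set.Ioi 0 := Set.Ioc_union_Ioi_eq_Ioi hs.le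
  rw [← hsum, ← hsplit, setIntegral_union (Set.Ioc_disjoint_Ioi le_rfl) measurableSet_Ioi
    (hFint.mono_set Set.Ioc_subset_Ioi_self) (hFint.mono_set (Set.Ioi_subset_Ioi hs.le))]
  refine add_le_add ?_ ?_
  · refine (setIntegral_mono_on (hFint.mono_set Set.Ioc_subset_Ioi_self)
      (integrableOn_const (by simp)) measurableSet_Ioc fun t ht => h1 t ht.1).trans_eq ?_
    rw [setIntegral_const]
    simp [hs.le, mul_comm]
  · refine (setIntegral_mono_on (hFint.mono_set (Set.Ioi_subset_Ioi hs.le))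
      ((integrableOn_Ioi_rpow_of_lt (by linarith) hs).const_mul D) measurableSet_Ioi
      fun t ht => h2 t (hs.trans ht)).trans_eq ?_
    rw [integral_const_mul, integral_Ioi_rpow_of_lt (by linarith) hs,
      show -p + 1 = -(p - 1) by ring, neg_div_neg_eq, show -(p - 1) = 1 - p by ring]

/-- Recovers the energy from the approximate forms `⟨f, f - P_t f⟩ / t` as `t ↓ 0`. -/
theorem tendsto_one_sub_exp_div (l : ℝ) :
    Tendsto (fun t => (1 - Real.exp (-t * l)) / t) (nhdsWithin 0 (Set.Ioi 0)) (nhds l) := by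
  have h : HasDerivAt (fun t : ℝ => -Real.exp (-t * l)) l 0 := by
    have h0 : HasDerivAt (fun t : ℝ => -t * l) (-1 * l) 0 := (hasDerivAt_id' (0 : ℝ)).neg.mul_const l
    have h1 := h0.exp.fun_neg
    simpa using h1
  have := h.tendsto_slope_zero_right
  refine this.congr fun t => ?_
  simp [div_eq_inv_mul]
  left; ring

/-! ### Energy estimates for multiplication by an eigenfunction. -/

namespace DiscreteOperator

variable {E : Type*} [MeasurableSpace E] {μ : Measure E} {L : DiscreteOperator μ}

theorem inner_e_sum (N : ℕ) (b : ℕ → ℝ) (i : ℕ) :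
    ⟪L.e i, ∑ j ∈ Finset.range N, b j • L.e j⟫ = if i ∈ Finset.range N then b i else 0 := by
  simp only [inner_sum, real_inner_smul_right, inner_e_e, mul_ite, mul_one, mul_zero]
  rw [Finset.sum_ite_eq]

theorem inner_sum_e (f : Lp ℝ 2 μ) (N : ℕ) (b : ℕ → ℝ) :
    ⟪f, ∑ j ∈ Finset.range N, b j • L.e j⟫ = ∑ j ∈ Finset.range N, b j * ⟪L.e j, f⟫ := by
  simp only [inner_sum, real_inner_smul_right, real_inner_comm f]

/-- The form bound `∫ e² y² ≤ K 𝓔(y, y)` for a bounded eigenfunction `e`, where `K` bounds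
`∫₀^∞ ‖P_t e²‖_∞ dt`. -/
theorem IsSubMarkovian.norm_bddMul_e_sq_le [SigmaFinite μ] (hL : L.IsSubMarkovian) {k : ℕ}
    {M D p s : ℝ} (hM : 0 < M) (hD0 : 0 ≤ D) (hp : 1 < p) (hs : 0 < s)
    (heM : ∀ᵐ a ∂μ, |L.e k a| ≤ M) {z : Lp ℝ ∞ μ} (hz : z =ᵐ[μ] L.e k)
    (hD : ∀ (t : ℝ) (ht : 0 < t),
      ∀ᵐ a ∂μ, L.semigroupCLM ht.le (bddMul z (L.e k)) a ≤ D * t ^ (-p))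
    (N : ℕ) (b : ℕ → ℝ) {w : Lp ℝ ∞ μ} (hw : w =ᵐ[μ] (∑ j ∈ Finset.range N, b j • L.e j : Lp ℝ 2 μ)) :
    ‖bddMul z (∑ j ∈ Finset.range N, b j • L.e j)‖ ^ 2 ≤
      (M ^ 2 * s + D * (s ^ (1 - p) / (p - 1))) * ∑ j ∈ Finset.range N, L.ev j * b j ^ 2 := by
  set y := ∑ j ∈ Finset.range N, b j • L.e j with hy
  set V := bddMul z (L.e k) with hV
  set R := ‖bddMul z y‖ ^ 2 with hR
  have hVae : ∀ᵐ a ∂μ, V a = L.e k a ^ 2 := by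
    filter_upwards [coeFn_bddMul z (L.e k), hz] with a h1 h2
    rw [hV, h1, h2, sq]
  have hV0 : 0 ≤ V := by
    rw [← Lp.coeFn_nonneg]
    filter_upwards [hVae] with a h
    rw [h]; exact sq_nonneg _
  have hVM : ∀ᵐ a ∂μ, 0 ≤ V a ∧ V a ≤ M ^ 2 := by
    filter_upwards [hVae, heM] with a h1 h2
    rw [h1]
    exact ⟨sq_nonneg _, sq_le_sq' (by linarith [(abs_le.mp h2).1]) (abs_le.mp h2).2⟩
  have hRint : R = ∫ a, bddMul z y a * bddMul z y a ∂μ := by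
    rw [hR, ← real_inner_self_eq_norm_sq, inner_eq_integral_mul]
  have hbound : ∀ (t : ℝ) (ht : 0 < t) (K : ℝ), (∀ᵐ a ∂μ, L.semigroupCLM ht.le V a ≤ K) →
      ∑ j ∈ Finset.range N, Real.exp (-t * L.ev j) * ⟪L.e j, bddMul w V⟫ ^ 2 ≤ K * R := by
    intro t ht K hK
    -- With `v = 0` and multiplier `y` this reads `⟨yV, P_t(yV)⟩ ≤ ⟨y²V, P_t V⟩`, where `V = eₖ²`.
    have h1 := inner_bddMul_sub_le (P := L.semigroupCLM ht.le) (fun f hf => hL.nonneg ht hf)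
      (L.semigroupCLM_symm ht.le) (u := V) (v := 0) hV0 (by simpa using hV0) w
    simp only [map_zero, inner_zero_left, sub_zero] at h1
    have h2 : ⟪bddMul w (bddMul w V), L.semigroupCLM ht.le V⟫ ≤ K * R := by
      rw [inner_eq_integral_mul, hRint, ← integral_const_mul]
      refine integral_mono_ae (integrable_mul_of_L2 _ _)
        ((integrable_mul_of_L2 _ _).const_mul K) ?_
      filter_upwards [hK, coeFn_bddMul w (bddMul w V), coeFn_bddMul w V, hVae, hw,
        coeFn_bddMul z y, hz] with a h1 h2 h3 h4 h5 h6 h7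
      rw [h2, h3, h4, h5, h6, h7]
      have := mul_le_mul_of_nonneg_left h1 (sq_nonneg (L.e k a * y a))
      linarith
    refine le_trans ?_ ((sub_nonneg.mp h1).trans h2)
    refine (sum_le_hasSum (Finset.range N) (fun j _ => ?_)
      ((L.hasSum_inner_semigroup ht.le (bddMul w V) (bddMul w V)).of_forall_eq
        fun j => by rw [← sq]))
    positivity
  -- Time integration bounds the first `N` terms of the squared `H`-norm of `yV` by `K R`. As `R =
  -- ⟨y, yV⟩` and `y` has only these `N` coefficients, Cauchy–Schwarz gives `R² ≤ 𝓔(y,y) K R`, and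
  -- `R` cancels.
  have hsum := sum_div_le_of_sum_exp_le (Finset.range N) (l := L.ev)
    (a := fun j => ⟪L.e j, bddMul w V⟫ ^ 2) L.ev_pos (A := M ^ 2 * R) (D := D * R) hs hp
    (fun t ht => hbound t ht _ (hL.le_const ht (by positivity) hVM))
    (fun t ht => (hbound t ht _ (hD t ht)).trans_eq (by ring))
  have hRy : R = ∑ j ∈ Finset.range N, b j * ⟪L.e j, bddMul w V⟫ := by
    rw [← inner_sum_e, ← hy, hRint, inner_eq_integral_mul]
    refine integral_congr_ae ?_
    filter_upwards [coeFn_bddMul w V, hVae, hw, coeFn_bddMul z y, hz] with a h3 h4 h5 h6 h7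
    rw [h3, h4, h5, h6, h7]; ring
  have hcs : R ^ 2 ≤ (∑ j ∈ Finset.range N, L.ev j * b j ^ 2) *
      ∑ j ∈ Finset.range N, ⟪L.e j, bddMul w V⟫ ^ 2 / L.ev j := by
    rw [hRy]
    refine Finset.sum_sq_le_sum_mul_sum_of_sq_le_mul _
      (fun j _ => mul_nonneg (L.ev_pos j).le (sq_nonneg _))
      (fun j _ => div_nonneg (sq_nonneg _) (L.ev_pos j).le) fun j _ => le_of_eq ?_
    have := (L.ev_pos j).ne'
    field_simp
  have hE : 0 ≤ ∑ j ∈ Finset.range N, L.ev j * b j ^ 2 :=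
    Finset.sum_nonneg fun j _ => mul_nonneg (L.ev_pos j).le (sq_nonneg _)
  have h := hcs.trans (mul_le_mul_of_nonneg_left hsum hE)
  rcases (sq_nonneg ‖bddMul z y‖).eq_or_lt with h0 | h0
  · rw [hR, ← h0]
    have hDs : 0 ≤ M ^ 2 * s + D * (s ^ (1 - p) / (p - 1)) := by
      have := sub_pos.mpr hp
      positivity
    exact mul_nonneg hDs hE
  · refine le_of_mul_le_mul_right ?_ h0
    rw [← hR]
    linarith

/-- The energy of the product of an eigenfunction `e` bounded by `M` with `y`:
`𝓔(e y, e y) ≤ λ ∫ e² y² + M² 𝓔(y, y)`. -/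
theorem IsSubMarkovian.sum_ev_mul_inner_sq_le [SigmaFinite μ] (hL : L.IsSubMarkovian) {k : ℕ}
    {M : ℝ} (heM : ∀ᵐ a ∂μ, |L.e k a| ≤ M) {z : Lp ℝ ∞ μ} (hz : z =ᵐ[μ] L.e k)
    (N : ℕ) (b : ℕ → ℝ) {w : Lp ℝ ∞ μ} (hw : w =ᵐ[μ] (∑ j ∈ Finset.range N, b j • L.e j : Lp ℝ 2 μ))
    (S : Finset ℕ) :
    ∑ i ∈ S, L.ev i * ⟪L.e i, bddMul z (∑ j ∈ Finset.range N, b j • L.e j)⟫ ^ 2 ≤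
      L.ev k * ‖bddMul z (∑ j ∈ Finset.range N, b j • L.e j)‖ ^ 2 +
        M ^ 2 * ∑ j ∈ Finset.range N, L.ev j * b j ^ 2 := by
  set y := ∑ j ∈ Finset.range N, b j • L.e j with hy
  set v := bddMul z y
  have hexp : ∀ t : ℝ, ∀ i, 1 - Real.exp (-t * L.ev i) ≤ t * L.ev i := fun t i => by
    have := Real.add_one_le_exp (-t * L.ev i)
    linarith
  have hsub : ∀ (t : ℝ) (ht : 0 ≤ t) (f : Lp ℝ 2 μ),
      HasSum (fun i => (1 - Real.exp (-t * L.ev i)) * ⟪L.e i, f⟫ ^ 2)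
        (‖f‖ ^ 2 - ⟪f, L.semigroupCLM ht f⟫) := fun t ht f =>
    ((L.hasSum_inner_sq f).sub (L.hasSum_inner_semigroup ht f f)).of_forall_eq fun i => by ring
  -- The eigenfunction inequality for `P_t` has `r = e^{-tλₖ}`. Adding `(1 - r) ‖v‖² ≤ t λₖ ‖v‖²`
  -- completes its left side to the approximate form of `v`. Only a finite set `S` of modes is kept,
  -- so `v` need not be known to have finite energy.
  have hpt : ∀ t : ℝ, 0 < t →
      ∑ i ∈ S, (1 - Real.exp (-t * L.ev i)) / t * ⟪L.e i, v⟫ ^ 2 ≤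
      L.ev k * ‖v‖ ^ 2 + M ^ 2 * ∑ j ∈ Finset.range N, L.ev j * b j ^ 2 := by
    intro t ht
    have h1 := inner_bddMul_eigenfunction_le (P := L.semigroupCLM ht.le)
      (fun f hf => hL.nonneg ht hf) (L.semigroupCLM_symm ht.le)
      (fun s hs hμ => (hL.indicator ht hs hμ).mono fun a ha => ha.2)
      (L.semigroupCLM_e ht.le k) heM hz hw
    have h2 : ∑ i ∈ S, (1 - Real.exp (-t * L.ev i)) * ⟪L.e i, v⟫ ^ 2 ≤
        ‖v‖ ^ 2 - ⟪v, L.semigroupCLM ht.le v⟫ := by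
      refine sum_le_hasSum S (fun i _ => mul_nonneg ?_ (sq_nonneg _)) (hsub t ht.le v)
      rw [sub_nonneg, Real.exp_le_one_iff]
      nlinarith [L.ev_pos i]
    have h3 : ‖y‖ ^ 2 - ⟪y, L.semigroupCLM ht.le y⟫ ≤
        t * ∑ j ∈ Finset.range N, L.ev j * b j ^ 2 := by
      have hs := hasSum_sum_of_ne_finset_zero (L := .unconditional ℕ) (s := Finset.range N)
        (f := fun i => (1 - Real.exp (-t * L.ev i)) * ⟪L.e i, y⟫ ^ 2) fun i hi => by
          rw [hy, inner_e_sum, if_neg hi]; simp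
      rw [(hsub t ht.le y).unique hs, Finset.mul_sum]
      refine Finset.sum_le_sum fun i hi => ?_
      rw [hy, inner_e_sum, if_pos hi]
      have := mul_le_mul_of_nonneg_right (hexp t i) (sq_nonneg (b i))
      linarith
    have h4 := mul_le_mul_of_nonneg_left h3 (sq_nonneg M)
    have h5 := mul_le_mul_of_nonneg_right (hexp t k) (sq_nonneg ‖v‖)
    have h6 : ∑ i ∈ S, (1 - Real.exp (-t * L.ev i)) * ⟪L.e i, v⟫ ^ 2 ≤
        t * (L.ev k * ‖v‖ ^ 2 + M ^ 2 * ∑ j ∈ Finset.range N, L.ev j * b j ^ 2) := by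
      refine h2.trans ?_
      change Real.exp (-t * L.ev k) * ‖v‖ ^ 2 - ⟪v, L.semigroupCLM ht.le v⟫ ≤ _ at h1
      linarith
    have h7 : ∑ i ∈ S, (1 - Real.exp (-t * L.ev i)) / t * ⟪L.e i, v⟫ ^ 2 =
        (∑ i ∈ S, (1 - Real.exp (-t * L.ev i)) * ⟪L.e i, v⟫ ^ 2) / t := by
      rw [Finset.sum_div]
      exact Finset.sum_congr rfl fun i _ => by ring
    rw [h7, div_le_iff₀ ht]
    linarith
  refine le_of_tendsto (f := fun t : ℝ => ∑ i ∈ S,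
    (1 - Real.exp (-t * L.ev i)) / t * ⟪L.e i, v⟫ ^ 2) (x := nhdsWithin 0 (Set.Ioi 0))
    (tendsto_finsetSum _ fun i _ => (tendsto_one_sub_exp_div (L.ev i)).mul_const _) ?_
  filter_upwards [self_mem_nhdsWithin] with t ht using hpt t ht

theorem exists_Linfty_of_abs_le {f : Lp ℝ 2 μ} {M : ℝ} (h : ∀ᵐ a ∂μ, |f a| ≤ M) :
    ∃ z : Lp ℝ ∞ μ, z =ᵐ[μ] f :=
  have hf : MemLp f ∞ μ := memLp_top_of_bound (Lp.aestronglyMeasurable f) M h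
  ⟨hf.toLp, hf.coeFn_toLp⟩

theorem exists_Linfty_sum {z : ℕ → Lp ℝ ∞ μ} (hz : ∀ k, z k =ᵐ[μ] L.e k) (N : ℕ) (b : ℕ → ℝ) :
    ∃ w : Lp ℝ ∞ μ, w =ᵐ[μ] (∑ j ∈ Finset.range N, b j • L.e j : Lp ℝ 2 μ) := by
  induction N with
  | zero =>
    refine ⟨0, ?_⟩
    filter_upwards [Lp.coeFn_zero ℝ ∞ μ, Lp.coeFn_zero ℝ 2 μ] with a h1 h2
    rw [Finset.range_zero, Finset.sum_empty, h1, h2]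
  | succ N ih =>
    obtain ⟨w, hw⟩ := ih
    refine ⟨w + b N • z N, ?_⟩
    rw [Finset.sum_range_succ]
    filter_upwards [hw, hz N, Lp.coeFn_add w (b N • z N), Lp.coeFn_smul (b N) (z N),
      Lp.coeFn_add (∑ j ∈ Finset.range N, b j • L.e j) (b N • L.e N),
      Lp.coeFn_smul (b N) (L.e N)] with a h1 h2 h3 h4 h5 h6
    rw [h3, h5, Pi.add_apply, Pi.add_apply, h4, h6, Pi.smul_apply, Pi.smul_apply, h1, h2]

theorem hInner_self_nonneg (x : Lp ℝ 2 μ) : 0 ≤ L.hInner x x :=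
  tsum_nonneg fun k => div_nonneg (mul_self_nonneg _) (L.ev_pos k).le

/-- By duality, a bound of multiplication by `z` in the energy norm is one in the norm of `H`. -/
theorem hInner_bddMul_le {z : Lp ℝ ∞ μ} {K : ℝ}
    (hK : ∀ (N : ℕ) (b : ℕ → ℝ) (S : Finset ℕ),
      ∑ i ∈ S, L.ev i * ⟪L.e i, bddMul z (∑ j ∈ Finset.range N, b j • L.e j)⟫ ^ 2 ≤
        K * ∑ j ∈ Finset.range N, L.ev j * b j ^ 2) (x : Lp ℝ 2 μ) :
    L.hInner (bddMul z x) (bddMul z x) ≤ K * L.hInner x x := by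
  refine le_of_tendsto' (L.summable_hInner _ _).hasSum.tendsto_sum_nat fun N => ?_
  set c : ℕ → ℝ := fun j => ⟪L.e j, bddMul z x⟫
  -- The test function `y` is `L⁻¹(z x)` cut to `N` modes. Then `T` is at once the truncated squared
  -- `H`-norm of `z x`, the energy of `y`, and `⟨x, z y⟩`; Cauchy–Schwarz gives `T² ≤ ‖x‖_H² K T`.
  set b : ℕ → ℝ := fun j => c j / L.ev j
  set y := ∑ j ∈ Finset.range N, b j • L.e j
  set T := ∑ j ∈ Finset.range N, L.ev j * b j ^ 2
  have hT1 : ∑ j ∈ Finset.range N, ⟪bddMul z x, L.e j⟫ * ⟪bddMul z x, L.e j⟫ / L.ev j = T :=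
    Finset.sum_congr rfl fun j _ => by
      have := (L.ev_pos j).ne'
      rw [real_inner_comm]
      change c j * c j / L.ev j = L.ev j * (c j / L.ev j) ^ 2
      field_simp
  have hT2 : ⟪x, bddMul z y⟫ = T := by
    rw [← inner_bddMul_left, inner_sum_e]
    refine Finset.sum_congr rfl fun j _ => ?_
    have := (L.ev_pos j).ne'
    change c j / L.ev j * c j = L.ev j * (c j / L.ev j) ^ 2
    field_simp
  have hT0 : 0 ≤ T := Finset.sum_nonneg fun j _ => mul_nonneg (L.ev_pos j).le (sq_nonneg _)
  have hS : ∀ S : Finset ℕ, (∑ i ∈ S, ⟪x, L.e i⟫ * ⟪L.e i, bddMul z y⟫) ^ 2 ≤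
      L.hInner x x * (K * T) := fun S => by
    refine (Finset.sum_sq_le_sum_mul_sum_of_sq_le_mul S
      (f := fun i => ⟪x, L.e i⟫ * ⟪x, L.e i⟫ / L.ev i)
      (g := fun i => L.ev i * ⟪L.e i, bddMul z y⟫ ^ 2)
      (fun i _ => div_nonneg (mul_self_nonneg _) (L.ev_pos i).le)
      (fun i _ => mul_nonneg (L.ev_pos i).le (sq_nonneg _)) fun i _ => le_of_eq ?_).trans ?_
    · have := (L.ev_pos i).ne'
      field_simp
    · refine mul_le_mul ?_ (hK N b S) (Finset.sum_nonneg fun i _ =>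
        mul_nonneg (L.ev_pos i).le (sq_nonneg _)) (hInner_self_nonneg x)
      exact (L.summable_hInner x x).sum_le_tsum S
        fun i _ => div_nonneg (mul_self_nonneg _) (L.ev_pos i).le
  have hlim := le_of_tendsto' ((L.e.hasSum_inner_mul_inner x (bddMul z y)).pow 2) hS
  rw [hT2] at hlim
  rw [hT1]
  rcases hT0.eq_or_lt with h0 | h0
  · rw [← h0]
    -- The empty sum on the left forces `0 ≤ K λ₀`, hence `K ≥ 0`, which is all that is needed when
    -- `T = 0`.
    have h1 := hK 1 (fun _ => 1) ∅
    simp only [Finset.sum_empty, Finset.range_one, Finset.sum_singleton, one_pow, mul_one] at h1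
    exact mul_nonneg (nonneg_of_mul_nonneg_left h1 (L.ev_pos 0)) (hInner_self_nonneg x)
  · refine le_of_mul_le_mul_right ?_ h0
    linarith

/-- Multiplication by the eigenfunction `eₖ` is bounded on `H`, with norm at most
`√C λₖ^{p/2}`. -/
theorem exists_hInner_mul_e_le [SigmaFinite μ] (hL : L.IsSubMarkovian) {c d p : ℝ}
    (hc : 0 < c) (hU : L.IsUltracontractive c d) (hdp : d / 2 ≤ p) (hp : 1 < p) :
    ∃ C, 0 ≤ C ∧ ∃ z : ℕ → Lp ℝ ∞ μ, (∀ k, z k =ᵐ[μ] L.e k) ∧ ∀ k x,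
      L.hInner (bddMul (z k) x) (bddMul (z k) x) ≤ C * L.ev k ^ p * L.hInner x x := by
  obtain ⟨C, hC, hnorm⟩ := hU.exists_norm_le hc hdp
  have hp1 : 0 < p - 1 := sub_pos.mpr hp
  -- The sup bound of `eₖ` at time `t = 1/λₖ`, where the factor `e^{tλₖ}` is just `e`.
  set M : ℕ → ℝ := fun k => Real.exp 1 * Real.sqrt (C * (1 / L.ev k) ^ (-p)) with hM
  have hMpos : ∀ k, 0 < M k := fun k => by
    have := L.ev_pos k
    positivity
  have hMsq : ∀ k, M k ^ 2 = Real.exp 1 ^ 2 * C * L.ev k ^ p := fun k => by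
    have := L.ev_pos k
    rw [hM]
    simp only
    rw [mul_pow, Real.sq_sqrt (by positivity), one_div, Real.inv_rpow this.le,
      Real.rpow_neg this.le, inv_inv, mul_assoc]
  have heM : ∀ k, ∀ᵐ a ∂μ, |L.e k a| ≤ M k := fun k => by
    have := L.abs_e_le (one_div_pos.mpr (L.ev_pos k)) (hnorm _ (one_div_pos.mpr (L.ev_pos k))) k
    rwa [one_div_mul_cancel (L.ev_pos k).ne'] at this
  choose z hz using fun k => exists_Linfty_of_abs_le (heM k)
  -- With `s = 1/λₖ`, the three terms come from `λₖ Mₖ² s`, from `λₖ D s^(1-p)/(p-1)` with `D = C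
  -- 2^p`, and from `Mₖ²`; each is a constant times `λₖ^p`.
  refine ⟨Real.exp 1 ^ 2 * C + C * 2 ^ p / (p - 1) + Real.exp 1 ^ 2 * C, by positivity, z, hz,
    fun k x => hInner_bddMul_le (fun N b S => ?_) x⟩
  have hev := L.ev_pos k
  obtain ⟨w, hw⟩ := exists_Linfty_sum hz N b
  have hVae : ∀ᵐ a ∂μ, bddMul (z k) (L.e k) a = L.e k a * L.e k a := by
    filter_upwards [coeFn_bddMul (z k) (L.e k), hz k] with a h1 h2
    rw [h1, h2]
  have hVint : Integrable (bddMul (z k) (L.e k)) μ :=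
    (integrable_mul_of_L2 (L.e k) (L.e k)).congr (hVae.mono fun a ha => ha.symm)
  have hV1 : ∫ a, |bddMul (z k) (L.e k) a| ∂μ = 1 := by
    rw [integral_congr_ae (g := fun a => L.e k a * L.e k a) (hVae.mono fun a ha => by
      simp only [ha, abs_mul_self]), ← inner_eq_integral_mul, inner_e_e, if_pos rfl]
  have hD : ∀ (t : ℝ) (ht : 0 < t),
      ∀ᵐ a ∂μ, L.semigroupCLM ht.le (bddMul (z k) (L.e k)) a ≤ C * 2 ^ p * t ^ (-p) := by
    intro t ht
    -- `eₖ²` has integral `1`; the factor `2^p` comes from using the bound at time `t/2`.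
    have := L.semigroupCLM_le ht (hnorm _ (half_pos ht)) hVint
    rw [hV1, mul_one, Real.sq_sqrt (by positivity), Real.div_rpow ht.le (by norm_num),
      Real.rpow_neg (by norm_num : (0 : ℝ) ≤ 2), div_inv_eq_mul] at this
    filter_upwards [this] with a ha
    linarith
  have h1 := hL.norm_bddMul_e_sq_le (hMpos k) (by positivity) hp (one_div_pos.mpr hev) (heM k) (hz k) hD N b hw
  have h2 := hL.sum_ev_mul_inner_sq_le (heM k) (hz k) N b hw S
  refine h2.trans ((add_le_add_left (mul_le_mul_of_nonneg_left h1 hev.le) _).trans_eq ?_)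
  have h3 : (1 / L.ev k) ^ (1 - p) * L.ev k = L.ev k ^ p := by
    rw [one_div, Real.inv_rpow hev.le, ← Real.rpow_neg hev.le, ← Real.rpow_add_one hev.ne']
    congr 1; ring
  rw [hMsq, ← h3]
  field_simp

end DiscreteOperator

/-! ### Hilbert–Schmidt operators as square-summable sequences. -/

namespace HilbertSchmidt

variable {ι V F : Type*} [NormedAddCommGroup V] [InnerProductSpace ℝ V]
  [NormedAddCommGroup F] [InnerProductSpace ℝ F] [CompleteSpace F]

theorem summable_inner_smul (b : HilbertBasis ι ℝ V) (w : lp (fun _ : ι => F) 2) (h : V) :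
    Summable (fun i => ⟪b i, h⟫ • w i) ∧ ‖∑' i, ⟪b i, h⟫ • w i‖ ≤ ‖w‖ * ‖h‖ := by
  have hw : HasSum (fun i => ‖w i‖ ^ (2 : ℝ)) (‖w‖ ^ (2 : ℝ)) := by
    simpa using lp.hasSum_norm (p := 2) (by norm_num) w
  have hh : HasSum (fun i => |⟪b i, h⟫| ^ (2 : ℝ)) (‖h‖ ^ (2 : ℝ)) := by
    have := lp.hasSum_norm (p := 2) (by norm_num) (b.repr h)
    simpa [b.repr_apply_apply] using this
  obtain ⟨C, -, hC, hsum⟩ := Real.inner_le_Lp_mul_Lq_hasSum_of_nonneg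
    (p := 2) (q := 2) (by constructor <;> norm_num) (norm_nonneg w) (norm_nonneg h)
    (fun i => norm_nonneg (w i)) (fun i => abs_nonneg ⟪b i, h⟫) hw hh
  have hle : ∀ i, ‖⟪b i, h⟫ • w i‖ ≤ ‖w i‖ * |⟪b i, h⟫| := fun i => by
    rw [norm_smul, mul_comm, Real.norm_eq_abs]
  exact ⟨Summable.of_norm_bounded hsum.summable hle,
    (tsum_of_norm_bounded hsum hle).trans hC⟩

/-- The Hilbert–Schmidt operator `h ↦ ∑ᵢ ⟨bᵢ, h⟩ wᵢ` of a square-summable sequence `w`. -/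
def ofSeq (b : HilbertBasis ι ℝ V) (w : lp (fun _ : ι => F) 2) : HilbertSchmidt b F :=
  let T : V →L[ℝ] F := LinearMap.mkContinuous
    { toFun := fun h => ∑' i, ⟪b i, h⟫ • w i
      map_add' := fun g h => by
        rw [← (summable_inner_smul b w g).1.tsum_add (summable_inner_smul b w h).1]
        simp only [inner_add_right, add_smul]
      map_smul' := fun r h => by
        rw [RingHom.id_apply, ← (summable_inner_smul b w h).1.tsum_const_smul]
        simp only [real_inner_smul_right, mul_smul] } ‖w‖ fun h => (summable_inner_smul b w h).2
  ⟨T, by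
    have : (fun i => T (b i)) = w := by
      classical
      funext j
      change ∑' i, ⟪b i, b j⟫ • w i = w j
      rw [tsum_eq_single j fun i hi => by
        rw [orthonormal_iff_ite.mp b.orthonormal, if_neg hi, zero_smul],
        orthonormal_iff_ite.mp b.orthonormal, if_pos rfl, one_smul]
    change Memℓp (fun i => T (b i)) 2
    rw [this]
    exact w.2⟩

theorem hasSum_ofSeq (b : HilbertBasis ι ℝ V) (w : lp (fun _ : ι => F) 2) (h : V) :
    HasSum (fun i => ⟪b i, h⟫ • w i) ((ofSeq b w).toCLM h) :=
  (summable_inner_smul b w h).1.hasSum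

theorem toSeq_ofSeq (b : HilbertBasis ι ℝ V) (w : lp (fun _ : ι => F) 2) :
    toSeq b (ofSeq b w) = w := by
  classical
  ext j
  refine (hasSum_ofSeq b w (b j)).unique ?_
  convert hasSum_single (f := fun i => ⟪b i, b j⟫ • w i) j fun i hi => ?_ using 1
  · rw [orthonormal_iff_ite.mp b.orthonormal, if_pos rfl, one_smul]
  · rw [orthonormal_iff_ite.mp b.orthonormal, if_neg hi, zero_smul]

theorem norm_ofSeq (b : HilbertBasis ι ℝ V) (w : lp (fun _ : ι => F) 2) :
    ‖ofSeq b w‖ = ‖w‖ := by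
  conv_rhs => rw [← toSeq_ofSeq b w]
  rfl

/-- A family of operators `T i` on `F` with `‖T i x‖² ≤ a i ‖x‖²` and `∑ a i < ∞` defines a bounded
operator `x ↦ (h ↦ ∑ᵢ ⟨bᵢ, h⟩ Tᵢ x)` into the Hilbert–Schmidt operators. -/
theorem exists_clm_hasSum {G : Type*} [NormedAddCommGroup G] [NormedSpace ℝ G]
    (b : HilbertBasis ι ℝ V) (T : ι → G →L[ℝ] F) {a : ι → ℝ} (ha : Summable a)
    (hT : ∀ i x, ‖T i x‖ ^ 2 ≤ a i * ‖x‖ ^ 2) :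
    ∃ B : G →L[ℝ] HilbertSchmidt b F, ∀ x h,
      HasSum (fun i => ⟪b i, h⟫ • T i x) ((B x).toCLM h) := by
  have hmem : ∀ x, Memℓp (fun i => T i x) 2 := fun x => by
    refine memℓp_gen ?_
    simp only [ENNReal.toReal_ofNat, Real.rpow_ofNat]
    exact Summable.of_nonneg_of_le (fun i => sq_nonneg _) (fun i => hT i x) (ha.mul_right _)
  refine ⟨LinearMap.mkContinuous
    { toFun := fun x => ofSeq b ⟨_, hmem x⟩
      map_add' := fun x y => toSeq_injective b (by
        rw [map_add]
        simp only [toSeq_ofSeq]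
        ext i
        exact map_add (T i) x y)
      map_smul' := fun r x => toSeq_injective b (by
        rw [map_smul]
        simp only [toSeq_ofSeq]
        ext i
        exact map_smul (T i) r x) } (Real.sqrt (∑' i, a i)) fun x => ?_,
    fun x h => hasSum_ofSeq b ⟨_, hmem x⟩ h⟩
  change ‖ofSeq b ⟨_, hmem x⟩‖ ≤ _
  rw [← Real.sqrt_sq (norm_nonneg x), ← Real.sqrt_mul' _ (sq_nonneg _), ← tsum_mul_right,
    norm_ofSeq]
  refine Real.le_sqrt_of_sq_le ?_
  have h := lp.norm_rpow_eq_tsum (p := 2) (by norm_num) (⟨_, hmem x⟩ : lp (fun _ : ι => F) 2)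
  simp only [ENNReal.toReal_ofNat, Real.rpow_ofNat] at h
  rw [h]
  refine Summable.tsum_le_tsum (fun i => hT i x) ?_ (ha.mul_right _)
  exact Summable.of_nonneg_of_le (fun i => sq_nonneg _) (fun i => hT i x) (ha.mul_right _)

end HilbertSchmidt

/-! ### Passage to the completion `H`. -/

namespace DiscreteOperator

variable {E : Type*} [MeasurableSpace E] {μ : Measure E} (L : DiscreteOperator μ)

/-- The canonical embedding of `L²(μ)` into `H`, as a linear map. -/
def toHLinear : Lp ℝ 2 μ →ₗ[ℝ] L.H :=
  (UniformSpace.Completion.toComplL (𝕜 := ℝ) (E := L.PreH)).toLinearMap ∘ₗ L.toPreH.toLinearMap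

theorem norm_toH_sq (x : Lp ℝ 2 μ) : ‖L.toH x‖ ^ 2 = L.hInner x x := by
  rw [← real_inner_self_eq_norm_sq, inner_toH]

end DiscreteOperator

/-- As every `eₖ` is bounded, the default value `0` in `mulL2` is never taken for the products `x
eₖ`. -/
theorem mulL2_eq_bddMul {E : Type*} [MeasurableSpace E] {μ : Measure E} {x y : Lp ℝ 2 μ}
    {z : Lp ℝ ∞ μ} (hz : z =ᵐ[μ] y) :
    MemLp (fun a => x a * y a) 2 μ ∧ mulL2 x y = bddMul z x := by
  have h : (fun a => x a * y a) =ᵐ[μ] bddMul z x := by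
    filter_upwards [coeFn_bddMul z x, hz] with a h1 h2
    rw [h1, h2, mul_comm]
  have hmem : MemLp (fun a => x a * y a) 2 μ := (memLp_congr_ae h).mpr (Lp.memLp _)
  refine ⟨hmem, ?_⟩
  rw [mulL2, dif_pos hmem]
  exact Lp.ext (hmem.coeFn_toLp.trans h)

/-- A real `sSup` of an unbounded set is `0` by convention, so finiteness of `ρ₃` has to be stated
as boundedness. -/
theorem ContinuousLinearMap.bddAbove_norm_sq_unit_sphere {G F : Type*} [NormedAddCommGroup G]
    [NormedSpace ℝ G] [NormedAddCommGroup F] [NormedSpace ℝ F] (B : G →L[ℝ] F) :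
    BddAbove ((fun x : G => ‖B x‖ ^ 2) '' {x | ‖x‖ ^ 2 = 1}) := by
  refine ⟨‖B‖ ^ 2, ?_⟩
  rintro _ ⟨x, hx, rfl⟩
  have h := pow_le_pow_left₀ (norm_nonneg _) (B.le_opNorm x) 2
  rwa [mul_pow, show ‖x‖ ^ 2 = 1 from hx, mul_one] at h

theorem ContinuousLinearMap.norm_sq_le_sSup_mul {G F : Type*} [NormedAddCommGroup G]
    [NormedSpace ℝ G] [NormedAddCommGroup F] [NormedSpace ℝ F] (B : G →L[ℝ] F) (x : G) :
    ‖B x‖ ^ 2 ≤ sSup ((fun x : G => ‖B x‖ ^ 2) '' {x | ‖x‖ ^ 2 = 1}) * ‖x‖ ^ 2 := by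
  rcases eq_or_ne x 0 with rfl | hx
  · simp
  have hn : ‖x‖ ≠ 0 := norm_ne_zero_iff.mpr hx
  have h := le_csSup B.bddAbove_norm_sq_unit_sphere
    ⟨‖x‖⁻¹ • x, show ‖‖x‖⁻¹ • x‖ ^ 2 = 1 by
      rw [norm_smul, norm_inv, norm_norm, inv_mul_cancel₀ hn, one_pow], rfl⟩
  simp only [map_smul, norm_smul, norm_inv, norm_norm] at h
  have h2 := mul_le_mul_of_nonneg_right h (sq_nonneg ‖x‖)
  rwa [mul_pow, inv_pow, mul_right_comm, inv_mul_cancel₀ (pow_ne_zero 2 hn), one_mul] at h2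

end

theorem proposition3p1 {E : Type*} [MeasurableSpace E] (μ : Measure E) [SigmaFinite μ]
    (L : DiscreteOperator μ) (hL : L.IsSubMarkovian)
    (c d : ℝ) (hc : 0 < c) (hd : 0 < d) (hU : L.IsUltracontractive c d)
    (m : ℕ → ℝ) (ε : ℝ) (hε : 0 < ε)
    (hm : Summable fun k => m k ^ 2 * L.ev k ^ max (d / 2) (1 + ε)) :
    -- the products `x eₖ` belong to `L²(μ)`
    (∀ (x : Lp ℝ 2 μ) (k : ℕ), MemLp (fun a => x a * L.e k a) 2 μ) ∧
    ∃ B : L.H →L[ℝ] HilbertSchmidt L.e L.H,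
      -- on `L²(μ)`, `B(x) h = ∑ₖ μₖ ⟨h, eₖ⟩ x eₖ`, with convergence in `H`
      (∀ x h : Lp ℝ 2 μ,
        HasSum (fun k => (m k * ⟪h, L.e k⟫) • L.toH (mulL2 x (L.e k)))
          ((B (L.toH x)).toCLM h)) ∧
      -- `B` is the only continuous extension
      (∀ B' : L.H → HilbertSchmidt L.e L.H, Continuous B' →
        (∀ x : Lp ℝ 2 μ, B' (L.toH x) = B (L.toH x)) → ∀ x, B' x = B x) ∧
      -- `ρ₃` is a finite supremum, and it gives the bound
      BddAbove ((fun x : L.H => ‖B x‖ ^ 2) '' {x | ‖x‖ ^ 2 = 1}) ∧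
      ∃ ρ₃ : ℝ, ρ₃ = 1 / 2 * sSup ((fun x : L.H => ‖B x‖ ^ 2) '' {x | ‖x‖ ^ 2 = 1}) ∧
        ∀ x : L.H, ‖B x‖ ^ 2 ≤ 2 * ρ₃ * ‖x‖ ^ 2 := by
  set p := max (d / 2) (1 + ε)
  have hp1 : 1 < p := lt_of_lt_of_le (by linarith) (le_max_right _ _)
  obtain ⟨C, hC, z, hz, hbound⟩ :=
    DiscreteOperator.exists_hInner_mul_e_le hL hc hU (le_max_left _ (1 + ε)) hp1
  refine ⟨fun x k => (mulL2_eq_bddMul (hz k)).1, ?_⟩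
  let f : ℕ → Lp ℝ 2 μ →ₗ[ℝ] L.H := fun k => L.toHLinear ∘ₗ (bddMul (z k)).toLinearMap
  have hdense : DenseRange L.toHLinear := L.denseRange_toH
  have hf : ∀ k x, ‖f k x‖ ≤ Real.sqrt (C * L.ev k ^ p) * ‖L.toHLinear x‖ := fun k x => by
    have hev := L.ev_pos k
    rw [← Real.sqrt_sq (norm_nonneg (L.toHLinear x)), ← Real.sqrt_mul (by positivity)]
    refine Real.le_sqrt_of_sq_le ?_
    change ‖L.toH (bddMul (z k) x)‖ ^ 2 ≤ _ * ‖L.toH x‖ ^ 2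
    rw [L.norm_toH_sq, L.norm_toH_sq]
    exact hbound k x
  -- Multiplication by `eₖ`, extended from `L²(μ)` to `H`; this is possible because `hf` bounds it
  -- in the norm of `H` on both sides.
  let T : ℕ → L.H →L[ℝ] L.H := fun k => (f k).extendOfNorm L.toHLinear
  have hTx : ∀ k x, T k (L.toH x) = L.toH (mulL2 x (L.e k)) := fun k x => by
    rw [(mulL2_eq_bddMul (hz k)).2]
    exact LinearMap.extendOfNorm_eq hdense ⟨_, hf k⟩ x
  have hTn : ∀ k x, ‖(m k • T k) x‖ ^ 2 ≤ C * (m k ^ 2 * L.ev k ^ p) * ‖x‖ ^ 2 := fun k x => by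
    have hev := L.ev_pos k
    have h := pow_le_pow_left₀ (norm_nonneg _)
      (LinearMap.norm_extendOfNorm_apply_le hdense _ (hf k) x) 2
    rw [mul_pow, Real.sq_sqrt (by positivity)] at h
    rw [smul_apply, norm_smul, mul_pow, Real.norm_eq_abs, sq_abs]
    have := mul_le_mul_of_nonneg_left h (sq_nonneg (m k))
    change m k ^ 2 * ‖T k x‖ ^ 2 ≤ _ at this
    linarith
  obtain ⟨B, hB⟩ := HilbertSchmidt.exists_clm_hasSum L.e (fun k => m k • T k) (hm.mul_left C) hTn
  refine ⟨B, fun x h => ?_, fun B' hB' heq x => ?_, B.bddAbove_norm_sq_unit_sphere, _, rfl,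
    fun x => ?_⟩
  · have e : (fun k => (m k * ⟪h, L.e k⟫) • L.toH (mulL2 x (L.e k))) =
        fun k => ⟪L.e k, h⟫ • (m k • T k) (L.toH x) := funext fun k => by
      rw [smul_apply, hTx, smul_smul, real_inner_comm, mul_comm]
    rw [e]
    exact hB (L.toH x) h
  · exact congrFun (L.denseRange_toH.equalizer hB' B.continuous (funext heq)) x
  · refine (B.norm_sq_le_sSup_mul x).trans_eq ?_
    ring
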